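/- Theorem 1.2. Conventions. All maps are continuous, $\mathbb{R}^m$ carries the Euclidean metric, and $\dim$ is the Lebesgue covering dimension; for $k<0$ the inequality $\dim Z\le k$ means $Z=\emptyset$. $C(X,\mathbb{R}^m)$ is the set of all maps $X\to\mathbb{R}^m$ with the source limitation topology: a set $U$ is open if for each $g\in U$ there is a continuous $\alpha:X\to(0,\infty)$ such that every $h\in C(X,\mathbb{R}^m)$ with $\|g(x)-h(x)\|<\alpha(x)$ for all $x\in X$ belongs to $U$. Let $M_{m,d}$ be the space of all affine $d$-dimensional subspaces ($d$-planes) of $\mathbb{R}^m$ with its usual metric topology. For a space $Z$, a map $g:Z\to\mathbb{R}^m$ and an integer $q\ge 1$ let $$B_{q,d,m}(g)=\{\Pi\in M_{m,d} : |g^{-1}(\Pi)|\ge q\},$$ considered as a subspace of $M_{m,d}$. For a map $f:X\to Y$ let $\mathcal{P}(q,d,m,k)$ be the set of all $g\in C(X,\mathbb{R}^m)$ such that $\dim B_{q,d,m}(g|_{f^{-1}(y)})\le k$ for every $y\in Y$. Let $f:X\to Y$ be a perfect map between metrizable spaces with $\dim Y=0$, let $n\ge 0$ be an integer, and suppose that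 $f$ is $n$-dimensional in the sense that $\dim f^{-1}(y)\le n$ for every $y\in Y$. Then, for all integers $m,d\ge 0$: (a) $\mathcal{P}(3,1,m,3n+1-m)$ is dense and $G_\delta$ in $C(X,\mathbb{R}^m)$ provided $m\ge 2n+1$. (b) $\mathcal{P}(2,1,m,2n)$ is dense and $G_\delta$ in $C(X,\mathbb{R}^m)$ provided $m\ge 2n+1$. (c) $\mathcal{P}(1,d,m,n+d(m-d))$ is dense and $G_\delta$ in $C(X,\mathbb{R}^m)$ provided $m\ge n+d$. (d) $\mathcal{P}(4,1,3,0)$ is dense and $G_\delta$ in $C(X,\mathbb{R}^3)$ if $n=1$. -/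

import Mathlib

open Set Topology

/-- `CoveringDimLE X k` says that the Lebesgue covering dimension of `X` is at most `k`:
every finite open cover of `X` has a finite open refinement (again a cover of `X`) each point of
which lies in at most `k + 1` members. For every negative `k` it says exactly that `X` is
empty. -/
def CoveringDimLE (X : Type*) [TopologicalSpace X] (k : ℤ) : Prop :=
  ∀ U : Set (Set X), U.Finite → (∀ u ∈ U, IsOpen u) → ⋃₀ U = univ →
    ∃ V : Set (Set X), V.Finite ∧ (∀ v ∈ V, IsOpen v) ∧ ⋃₀ V = univ ∧
      (∀ v ∈ V, ∃ u ∈ U, v ⊆ u) ∧ ∀ x : X, ({v ∈ V | x ∈ v}.ncard : ℤ) ≤ k + 1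

/-- The set `M_{m,d}` of all `d`-planes, i.e. the (nonempty) `d`-dimensional affine subspaces
of Euclidean space `ℝ^m`. -/
def AffinePlane (m d : ℕ) : Type :=
  {P : AffineSubspace ℝ (EuclideanSpace ℝ (Fin m)) //
    (P : Set (EuclideanSpace ℝ (Fin m))).Nonempty ∧ Module.finrank ℝ P.direction = d}

namespace AffinePlane

variable {m d : ℕ}

/-- The set of points of a `d`-plane. -/
def points (P : AffinePlane m d) : Set (EuclideanSpace ℝ (Fin m)) := (P.1 : Set _)

/-- The point of a `d`-plane that is nearest to the origin. -/
noncomputable def foot (P : AffinePlane m d) : EuclideanSpace ℝ (Fin m) :=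
  haveI : Nonempty P.1 := P.2.1.to_subtype
  (EuclideanGeometry.orthogonalProjection P.1 0 : EuclideanSpace ℝ (Fin m))

/-- The orthogonal projection of `ℝ^m` onto the direction space of a `d`-plane. -/
noncomputable def directionProj (P : AffinePlane m d) :
    EuclideanSpace ℝ (Fin m) →L[ℝ] EuclideanSpace ℝ (Fin m) :=
  P.1.direction.starProjection

/-- The usual (metric) topology of the affine Grassmannian `M_{m,d}`: the one given by the metric
`dist P Q = max ‖foot P - foot Q‖ ‖directionProj P - directionProj Q‖`. -/
noncomputable instance : TopologicalSpace (AffinePlane m d) :=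
  TopologicalSpace.induced (fun P => (P.foot, P.directionProj)) inferInstance

end AffinePlane

/-- `B_{q,d,m}(g)`: the set of all `d`-planes `P` in `ℝ^m` whose preimage under `g` has at least
`q` points. As a type it carries the subspace topology. -/
def planesHitting (q d m : ℕ) {X : Type*} [TopologicalSpace X]
    (g : C(X, EuclideanSpace ℝ (Fin m))) : Set (AffinePlane m d) :=
  {P | (q : ℕ∞) ≤ (g ⁻¹' P.points).encard}

/-- `P(q,d,m,k)` for a map `f : X → Y`: the set of all maps `g : X → ℝ^m` such that
`dim B_{q,d,m}(g|f⁻¹(y)) ≤ k` for all `y`. -/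
def fiberwiseDimSet {X Y : Type*} [TopologicalSpace X] (f : X → Y) (q d m : ℕ) (k : ℤ) :
    Set C(X, EuclideanSpace ℝ (Fin m)) :=
  {g | ∀ y : Y, CoveringDimLE (planesHitting q d m (g.restrict (f ⁻¹' {y}))) k}

/-- The source limitation topology on the set of continuous maps `X → E`: a set `U` is open
if for each `g ∈ U` there is a continuous `α : X → (0, ∞)` such that `U` contains all continuous
`h` with `dist (g x) (h x) < α x` for all `x`. -/
@[reducible] def sourceLimitationTopology (X E : Type*) [TopologicalSpace X] [PseudoMetricSpace E] :
    TopologicalSpace C(X, E) where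
  IsOpen U := ∀ g ∈ U, ∃ α : C(X, ℝ), (∀ x, 0 < α x) ∧
    ∀ h : C(X, E), (∀ x, dist (g x) (h x) < α x) → h ∈ U
  isOpen_univ := fun _ _ => ⟨ContinuousMap.const X 1, fun _ => one_pos, fun _ _ => mem_univ _⟩
  isOpen_inter := by
    intro U V hU hV g hg
    obtain ⟨α, hα, hα'⟩ := hU g hg.1
    obtain ⟨β, hβ, hβ'⟩ := hV g hg.2
    exact ⟨α ⊓ β, fun x => lt_min (hα x) (hβ x), fun h hh =>
      ⟨hα' h fun x => (hh x).trans_le (min_le_left _ _),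
        hβ' h fun x => (hh x).trans_le (min_le_right _ _)⟩⟩
  isOpen_sUnion := by
    intro S hS g hg
    obtain ⟨U, hU, hgU⟩ := hg
    obtain ⟨α, hα, hα'⟩ := hS U hU g hgU
    exact ⟨α, hα, fun h hh => ⟨U, hU, hα' h hh⟩⟩

/-- `S` is a dense `G_δ` set in `C(X, E)` with the source limitation topology. -/
def IsDenseGdeltaSourceLimitation {X E : Type*} [TopologicalSpace X] [PseudoMetricSpace E]
    (S : Set C(X, E)) : Prop :=
  @Dense _ (sourceLimitationTopology X E) S ∧ @IsGδ _ (sourceLimitationTopology X E) S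

/-! Fix a fibre and require the `q` points of the fibre on a plane to be pairwise at distance at
least `δ`. The resulting planes form a compact set, `secants`, and $B_{q,d,m}$ of the fibre is the
union of these compact sets over `δ = 1/(j+1)` (`range_emb_planesHitting`). By the countable sum
theorem, $\dim B\le k$ holds exactly when each of them has arbitrarily fine open covers of order at
most $k+1$ (`coverOrderLE_iff_smallCover`). So the required set of maps is a countable intersection
of conditions, one for each separation and each mesh.

Each condition is open and dense. The cover consists of open sets of the ambient normed space, and
secant sets vary upper semicontinuously with the map and the fibre because $f$ is proper
(`secants_subset_of_near`); hence the condition persists under small perturbations and on nearby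
fibres. Since $\dim Y=0$, local choices over $Y$ can be made locally constant, so that
approximations found fibre by fibre glue together (`sourceLimitation_open_dense_of_fiberwise`). A
Baire argument for the source limitation topology (`sourceLimitation_baire`) then intersects the
conditions.

There remains density on one compact fibre of dimension at most $n$. A partition of unity
subordinate to a fine cover of order $n+1$ approximates the map by one into a polyhedron with
movable vertices, and `δ`-separated points use disjoint sets of vertices. The secants therefore lie
in finitely many sets `planesThrough`: the planes meeting the spans of `q` disjoint $(n+1)$-tuples
of vertices (`exists_approximation_smallCover_secants`). After the vertices are moved to general
position when needed, the Hausdorff dimension of these sets is bounded through smooth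
parametrizations; in case (d) the sets are finite. Hausdorff dimension less than `K` gives fine
covers of order at most `K`, by cubical lattices in generic position (`smallCover_of_dimH_lt`). -/

/-! ### Indexed covers and covering dimension -/

/-- Every finite open cover of `X` has an open shrinking of order at most `K`, i.e. each point lies
in at most `K` members: the covering dimension of `X` is less than `K`. -/
def CoverOrderLE (X : Type*) [TopologicalSpace X] (K : ℕ) : Prop :=
  ∀ (s : ℕ) (U : Fin s → Set X), (∀ i, IsOpen (U i)) → ⋃ i, U i = univ →
    ∃ V : Fin s → Set X, (∀ i, IsOpen (V i)) ∧ (∀ i, V i ⊆ U i) ∧ ⋃ i, V i = univ ∧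
      ∀ x, {i | x ∈ V i}.encard ≤ K

theorem encard_le_of_choice {α β : Type*} {s : Set α} {t : Set β} (φ : β → α → Prop)
    (h : ∀ a ∈ s, ∃ b ∈ t, φ b a) (hφ : ∀ b a a', φ b a → φ b a' → a = a') :
    s.encard ≤ t.encard := by
  classical
  rcases isEmpty_or_nonempty β with hβ | hβ
  · have : s = ∅ := eq_empty_of_forall_notMem fun a ha => hβ.elim (h a ha).choose
    simp [this]
  choose! ψ hψ hψ' using h
  exact Set.encard_le_encard_of_injOn (f := ψ) (fun a ha => hψ a ha) fun a ha a' ha' haa =>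
    hφ (ψ a) a a' (hψ' a ha) (haa ▸ hψ' a' ha')

theorem coveringDimLE_iff_coverOrderLE (X : Type*) [TopologicalSpace X] (k : ℤ) :
    CoveringDimLE X k ↔ CoverOrderLE X (k + 1).toNat := by
  constructor
  · intro h s U hU hUX
    obtain ⟨V, hVf, hVo, hVX, hVU, hVk⟩ := h (range U) (finite_range U)
      (by rintro _ ⟨i, rfl⟩; exact hU i) (by rw [sUnion_range]; exact hUX)
    have hφ : ∀ v ∈ V, ∃ i, v ⊆ U i := fun v hv => by
      obtain ⟨_, ⟨i, rfl⟩, hi⟩ := hVU v hv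
      exact ⟨i, hi⟩
    choose φ hφ using hφ
    refine ⟨fun i => ⋃₀ {v | ∃ hv : v ∈ V, φ v hv = i}, ?_, ?_, ?_, ?_⟩
    · exact fun i => isOpen_sUnion fun v ⟨hv, _⟩ => hVo v hv
    · rintro i x ⟨v, ⟨hv, rfl⟩, hx⟩
      exact hφ v hv hx
    · refine eq_univ_of_forall fun x => ?_
      obtain ⟨v, hv, hx⟩ := (hVX ▸ mem_univ x : x ∈ ⋃₀ V)
      exact mem_iUnion.2 ⟨φ v hv, v, ⟨hv, rfl⟩, hx⟩
    · intro x
      have h1 : {i | x ∈ ⋃₀ {v | ∃ hv : v ∈ V, φ v hv = i}}.encard ≤ {v ∈ V | x ∈ v}.encard := by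
        refine encard_le_of_choice (fun v i => ∃ hv : v ∈ V, φ v hv = i) ?_ ?_
        · rintro i ⟨v, ⟨hv, hi⟩, hx⟩
          exact ⟨v, ⟨hv, hx⟩, hv, hi⟩
        · rintro v i i' ⟨_, rfl⟩ ⟨_, rfl⟩
          rfl
      have hf : {v ∈ V | x ∈ v}.Finite := hVf.subset fun v hv => hv.1
      refine h1.trans ?_
      rw [← hf.cast_ncard_eq]
      have := hVk x
      exact_mod_cast (by omega : {v ∈ V | x ∈ v}.ncard ≤ (k + 1).toNat)
  · intro h U hUf hUo hUX
    obtain ⟨s, u, -, rfl⟩ := hUf.fin_param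
    obtain ⟨V, hVo, hVU, hVX, hVk⟩ := h s u (fun i => hUo _ ⟨i, rfl⟩)
      (by rw [← sUnion_range]; exact hUX)
    refine ⟨range V, finite_range V, by rintro _ ⟨i, rfl⟩; exact hVo i,
      by rw [sUnion_range]; exact hVX, ?_, ?_⟩
    · rintro _ ⟨i, rfl⟩
      exact ⟨u i, ⟨i, rfl⟩, hVU i⟩
    · intro x
      have hf : {v ∈ range V | x ∈ v}.Finite := (finite_range V).subset fun v hv => hv.1
      have h1 : {v ∈ range V | x ∈ v}.encard ≤ {i | x ∈ V i}.encard := by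
        refine encard_le_of_choice (fun i v => V i = v) ?_ ?_
        · rintro _ ⟨⟨i, rfl⟩, hx⟩
          exact ⟨i, hx, rfl⟩
        · rintro i _ _ rfl rfl
          rfl
      have h2 := h1.trans (hVk x)
      rw [← hf.cast_ncard_eq] at h2
      have h3 : {v ∈ range V | x ∈ v}.ncard ≤ (k + 1).toNat := by exact_mod_cast h2
      -- Positivity is needed because `toNat` truncates: for `k < -1` it turns the bound zero into a
      -- contradiction, so there is no point `x`.
      have h4 : 0 < {v ∈ range V | x ∈ v}.ncard := by
        rw [ncard_pos hf]
        obtain ⟨i, hi⟩ := mem_iUnion.1 (hVX ▸ mem_univ x : x ∈ ⋃ i, V i)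
        exact ⟨V i, ⟨i, rfl⟩, hi⟩
      omega

/-- A finite family of closed sets of order at most `K` swells to a family of open sets of order at
most `K`. -/
theorem exists_open_swelling {ι Z : Type*} [Finite ι] [PseudoEMetricSpace Z] {K : ℕ}
    (F U : ι → Set Z) (hF : ∀ i, IsClosed (F i)) (hU : ∀ i, IsOpen (U i)) (hFU : ∀ i, F i ⊆ U i)
    (hK : ∀ x, {i | x ∈ F i}.encard ≤ K) :
    ∃ W : ι → Set Z, (∀ i, IsOpen (W i)) ∧ (∀ i, F i ⊆ W i) ∧ (∀ i, W i ⊆ U i) ∧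
      ∀ x, {i | x ∈ W i}.encard ≤ K := by
  classical
  -- Extended distances keep empty members harmless (distance `⊤`). A point `x` is admitted to the
  -- `j`-th set only if at most `K` members are as close to `x` as `F j`. Among the sets containing
  -- `x`, the farthest `F j` then bounds their number.
  let d : ι → Z → ENNReal := fun i x => Metric.infEDist x (F i)
  have hd : ∀ i, Continuous (d i) := fun i => Metric.continuous_infEDist
  have hmem : ∀ i x, d i x = 0 ↔ x ∈ F i := fun i x => by
    rw [← Metric.mem_closure_iff_infEDist_zero, (hF i).closure_eq]
  refine ⟨fun j => U j ∩ {x | {i | d i x ≤ d j x}.encard ≤ K}, ?_, ?_, fun i => inter_subset_left,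
    ?_⟩
  · intro j
    refine (hU j).inter ?_
    have : {x | {i | d i x ≤ d j x}.encard ≤ K}ᶜ =
        ⋃ S ∈ {S : Set ι | (K : ℕ∞) < S.encard}, ⋂ i ∈ S, {x | d i x ≤ d j x} := by
      ext x
      simp only [mem_compl_iff, mem_ofPred_eq, not_le, mem_iUnion, mem_iInter, exists_prop]
      constructor
      · exact fun h => ⟨_, h, fun i hi => hi⟩
      · rintro ⟨S, hS, h⟩
        exact hS.trans_le (encard_le_encard fun i hi => h i hi)
    rw [← isClosed_compl_iff, this]
    exact (toFinite _).isClosed_biUnion fun S _ =>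
      isClosed_biInter fun i _ => isClosed_le (hd i) (hd j)
  · intro j x hx
    refine ⟨hFU j hx, ?_⟩
    have h0 : d j x = 0 := (hmem j x).2 hx
    have : {i | d i x ≤ d j x} = {i | x ∈ F i} := by
      ext i
      simp [h0, hmem]
    simpa only [mem_ofPred_eq, this] using hK x
  · intro x
    set S := {i | x ∈ U i ∩ {x | {i' | d i' x ≤ d i x}.encard ≤ K}} with hS
    rcases S.eq_empty_or_nonempty with h | h
    · simp [h]
    · obtain ⟨j, hj, hmax⟩ := exists_max_image S (fun i => d i x) (toFinite S) h
      exact (encard_le_encard fun i hi => hmax i hi).trans hj.2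

/-- The countable sum theorem for the covering dimension. -/
theorem coverOrderLE_of_iUnion_closed {T : Type*} [TopologicalSpace T]
    [TopologicalSpace.PseudoMetrizableSpace T] {K : ℕ} (F : ℕ → Set T) (hF : ∀ j, IsClosed (F j))
    (hFT : ⋃ j, F j = univ) (hK : ∀ j, CoverOrderLE (F j) K) : CoverOrderLE T K := by
  let := TopologicalSpace.pseudoMetrizableSpacePseudoMetric T
  intro s U hU hUT
  -- One shrinking corrects the order on `F j` only. Iterating over `j` with nested closures and
  -- intersecting yields closed sets of order at most `K` everywhere; they still cover because the
  -- index set is finite.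
  have step : ∀ (j : ℕ) (A : {A : Fin s → Set T // (∀ i, IsOpen (A i)) ∧ ⋃ i, A i = univ}),
      ∃ B : {A : Fin s → Set T // (∀ i, IsOpen (A i)) ∧ ⋃ i, A i = univ},
        (∀ i, closure (B.1 i) ⊆ A.1 i) ∧ ∀ x ∈ F j, {i | x ∈ closure (B.1 i)}.encard ≤ K := by
    rintro j ⟨A, hAo, hAT⟩
    obtain ⟨V, hVo, hVA, hVT, hVK⟩ := hK j s (fun i => (↑) ⁻¹' A i)
      (fun i => (hAo i).preimage continuous_subtype_val)
      (by rw [← preimage_iUnion, hAT, preimage_univ])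
    choose O hO hOV using fun i => isOpen_induced_iff.1 (hVo i)
    have hmem : ∀ x (hx : x ∈ F j) i, x ∈ O i ↔ (⟨x, hx⟩ : F j) ∈ V i := fun x hx i => by
      rw [← hOV i]; rfl
    obtain ⟨B, hBT, hBo, hBA⟩ := exists_iUnion_eq_closure_subset
      (u := fun i => A i ∩ (O i ∪ (F j)ᶜ))
      (fun i => (hAo i).inter ((hO i).union (hF j).isOpen_compl)) (fun x => toFinite _) (by
        refine eq_univ_of_forall fun x => mem_iUnion.2 ?_
        by_cases hx : x ∈ F j
        · obtain ⟨i, hi⟩ := mem_iUnion.1 (hVT ▸ mem_univ (⟨x, hx⟩ : F j) : _ ∈ ⋃ i, V i)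
          exact ⟨i, hVA i hi, Or.inl ((hmem x hx i).2 hi)⟩
        · obtain ⟨i, hi⟩ := mem_iUnion.1 (hAT ▸ mem_univ x : _ ∈ ⋃ i, A i)
          exact ⟨i, hi, Or.inr hx⟩)
    refine ⟨⟨B, hBo, hBT⟩, fun i => (hBA i).trans inter_subset_left, fun x hx => ?_⟩
    refine (encard_le_encard fun i hi => ?_).trans (hVK ⟨x, hx⟩)
    exact (hmem x hx i).1 ((hBA i hi).2.resolve_right fun h => h hx)
  choose B hBsub hBK using step
  let A : ℕ → {A : Fin s → Set T // (∀ i, IsOpen (A i)) ∧ ⋃ i, A i = univ} :=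
    fun j => Nat.rec ⟨U, hU, hUT⟩ (fun j A => B j A) j
  have hAsub : ∀ j i, closure ((A (j + 1)).1 i) ⊆ (A j).1 i := fun j i => hBsub j (A j) i
  have hanti : ∀ i, Antitone fun j => (A j).1 i := fun i =>
    antitone_nat_of_succ_le fun j => subset_closure.trans (hAsub j i)
  let G : Fin s → Set T := fun i => ⋂ j, closure ((A (j + 1)).1 i)
  have hGU : ∀ i, G i ⊆ U i := fun i => (iInter_subset _ 0).trans (hAsub 0 i)
  have hGT : ∀ x, ∃ i, x ∈ G i := by
    intro x
    by_contra! hx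
    have : ∀ i, ∃ j, x ∉ (A j).1 i := fun i => by
      by_contra! h
      exact hx i (mem_iInter.2 fun j => subset_closure (h (j + 1)))
    choose J hJ using this
    obtain ⟨N, hN⟩ := (finite_range J).bddAbove
    obtain ⟨i, hi⟩ := mem_iUnion.1 (show x ∈ ⋃ i, (A N).1 i by rw [(A N).2.2]; trivial)
    exact hJ i (hanti i (hN ⟨i, rfl⟩) hi)
  obtain ⟨W, hWo, hGW, hWU, hWK⟩ := exists_open_swelling (K := K) G U
    (fun i => isClosed_iInter fun j => isClosed_closure) hU hGU (fun x => by
      obtain ⟨j, hj⟩ := mem_iUnion.1 (hFT ▸ mem_univ x : x ∈ ⋃ j, F j)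
      exact le_trans (encard_le_encard fun i hi => mem_iInter.1 hi j) (hBK j (A j) x hj))
  exact ⟨W, hWo, hWU, eq_univ_of_forall fun x =>
    let ⟨i, hi⟩ := hGT x; mem_iUnion.2 ⟨i, hGW i hi⟩, hWK⟩

/-! ### Small covers of bounded order -/

/-- `C` is covered by a finite family of open sets of the ambient space `Z` of diameter less than
`ε` and of order at most `K` in `Z`. -/
def SmallCover {Z : Type*} [PseudoMetricSpace Z] (C : Set Z) (ε : ℝ) (K : ℕ) : Prop :=
  ∃ (s : ℕ) (W : Fin s → Set Z), (∀ i, IsOpen (W i)) ∧ C ⊆ ⋃ i, W i ∧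
    (∀ i, ∀ x ∈ W i, ∀ y ∈ W i, dist x y < ε) ∧ ∀ x, {i | x ∈ W i}.encard ≤ K

theorem SmallCover.of_finite {ι Z : Type*} [Finite ι] [PseudoMetricSpace Z] {C : Set Z} {ε : ℝ}
    {K : ℕ} (W : ι → Set Z) (hW : ∀ i, IsOpen (W i)) (hC : C ⊆ ⋃ i, W i)
    (hd : ∀ i, ∀ x ∈ W i, ∀ y ∈ W i, dist x y < ε) (hK : ∀ x, {i | x ∈ W i}.encard ≤ K) :
    SmallCover C ε K := by
  obtain ⟨s, ⟨e⟩⟩ := Finite.exists_equiv_fin ι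
  refine ⟨s, fun i => W (e.symm i), fun i => hW _, ?_, fun i => hd _, fun x => ?_⟩
  · rwa [e.symm.surjective.iUnion_comp W]
  · refine le_trans ?_ (hK x)
    exact Set.encard_le_encard_of_injOn (f := e.symm) (fun i hi => hi) e.symm.injective.injOn

theorem SmallCover.mono {Z : Type*} [PseudoMetricSpace Z] {C C' : Set Z} {ε : ℝ} {K : ℕ}
    (h : SmallCover C ε K) (hC : C' ⊆ C) : SmallCover C' ε K := by
  obtain ⟨s, W, hW, hCW, h⟩ := h
  exact ⟨s, W, hW, hC.trans hCW, h⟩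

theorem smallCover_empty {Z : Type*} [PseudoMetricSpace Z] (ε : ℝ) (K : ℕ) :
    SmallCover (∅ : Set Z) ε K :=
  .of_finite (fun i : Empty => i.elim) (fun i => i.elim) (empty_subset _) (fun i => i.elim)
    fun x => by rw [eq_empty_of_isEmpty {i : Empty | _}]; simp

/-- Below the Lebesgue number every small set lies in a member of the given cover; grouping the
small sets by a chosen such member does not raise the order. -/
theorem coverOrderLE_of_smallCover {T Z : Type*} [TopologicalSpace T] [CompactSpace T]
    [PseudoMetricSpace Z] {K : ℕ} {e : T → Z} (he : IsInducing e)
    (h : ∀ ε > 0, SmallCover (range e) ε K) : CoverOrderLE T K := by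
  intro s U hU hUT
  choose O hO hOU using fun i => he.isOpen_iff.1 (hU i)
  obtain ⟨δ, hδ, hδO⟩ := lebesgue_number_lemma_of_metric
    (isCompact_range he.continuous) hO (by
      rintro _ ⟨x, rfl⟩
      obtain ⟨i, hi⟩ := mem_iUnion.1 (hUT ▸ mem_univ x : x ∈ ⋃ i, U i)
      exact mem_iUnion.2 ⟨i, by rwa [← hOU i] at hi⟩)
  obtain ⟨r, W, hW, hTW, hWd, hWK⟩ := h δ hδ
  have hφ : ∀ a, (∃ x, e x ∈ W a) → ∃ i, e ⁻¹' W a ⊆ U i := by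
    rintro a ⟨x, hx⟩
    obtain ⟨i, hi⟩ := hδO (e x) ⟨x, rfl⟩
    exact ⟨i, fun y hy => by rw [← hOU i]; exact hi (hWd a _ hy _ hx)⟩
  choose φ hφ using hφ
  refine ⟨fun i => ⋃ a, ⋃ _ : ∃ ha : ∃ x, e x ∈ W a, φ a ha = i, e ⁻¹' W a, ?_, ?_, ?_, ?_⟩
  · exact fun i => isOpen_iUnion fun a => isOpen_iUnion fun _ => (hW a).preimage he.continuous
  · intro i x hx
    simp only [mem_iUnion] at hx
    obtain ⟨a, ⟨ha, rfl⟩, hx⟩ := hx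
    exact hφ a ha hx
  · refine eq_univ_of_forall fun x => ?_
    obtain ⟨a, ha⟩ := mem_iUnion.1 (hTW ⟨x, rfl⟩)
    simp only [mem_iUnion]
    exact ⟨φ a ⟨x, ha⟩, a, ⟨_, rfl⟩, ha⟩
  · intro x
    refine le_trans ?_ (hWK (e x))
    refine encard_le_of_choice (fun a i => ∃ ha, φ a ha = i) ?_ ?_
    · intro i hx
      simp only [mem_iUnion, mem_ofPred_eq] at hx
      obtain ⟨a, ha, hx⟩ := hx
      exact ⟨a, hx, ha⟩
    · rintro v i i' ⟨_, rfl⟩ ⟨_, rfl⟩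
      rfl

/-- The space `T` need not be compact, so the complement of `C` is added to a cover of `C` by balls
as one extra member, with index `0`. The other members of a shrinking cover `C`; closed shrinkings
of them inside `C` swell to open sets of `Z` without raising the order. -/
theorem CoverOrderLE.smallCover {T Z : Type*} [TopologicalSpace T] [MetricSpace Z] {K : ℕ}
    {e : T → Z} (he : IsInducing e) (h : CoverOrderLE T K) {C : Set Z} (hC : IsCompact C)
    (hCe : C ⊆ range e) {ε : ℝ} (hε : 0 < ε) : SmallCover C ε K := by
  obtain ⟨t, htC, htf, htcov⟩ := hC.finite_cover_balls (e := ε / 2) (half_pos hε)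
  obtain ⟨s, c, -, rfl⟩ := htf.fin_param
  obtain ⟨V, hVo, hVU, hVT, hVK⟩ := h (s + 1)
    (Fin.cons (e ⁻¹' Cᶜ) fun i => e ⁻¹' Metric.ball (c i) (ε / 2))
    (by
      refine Fin.cases ?_ fun i => ?_
      · exact hC.isClosed.isOpen_compl.preimage he.continuous
      · exact Metric.isOpen_ball.preimage he.continuous)
    (by
      refine eq_univ_of_forall fun x => mem_iUnion.2 ?_
      by_cases hx : e x ∈ C
      · have := htcov hx
        simp only [mem_iUnion, exists_prop] at this
        obtain ⟨_, ⟨i, rfl⟩, hi⟩ := this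
        exact ⟨i.succ, by simpa using hi⟩
      · exact ⟨0, hx⟩)
  choose O hO hOV using fun i => he.isOpen_iff.1 (hVo i)
  have hcov : C ⊆ ⋃ i : Fin s, O i.succ := by
    intro z hz
    obtain ⟨x, rfl⟩ := hCe hz
    obtain ⟨i, hi⟩ := mem_iUnion.1 (hVT ▸ mem_univ x : x ∈ ⋃ i, V i)
    refine i.cases (motive := fun i => x ∈ V i → _) ?_ ?_ hi
    · exact fun hi => absurd hz (hVU 0 hi)
    · intro i hi
      rw [← hOV] at hi
      exact mem_iUnion.2 ⟨i, hi⟩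
  obtain ⟨F, hCF, hF, hFO⟩ := exists_subset_iUnion_closed_subset hC.isClosed
    (fun i : Fin s => hO i.succ) (fun x _ => toFinite _) hcov
  obtain ⟨W, hWo, hFW, hWU, hWK⟩ := exists_open_swelling (K := K) (fun i => F i ∩ C)
    (fun i => Metric.ball (c i) (ε / 2)) (fun i => (hF i).inter hC.isClosed)
    (fun i => Metric.isOpen_ball) (by
      rintro i z ⟨hz, hzC⟩
      obtain ⟨x, rfl⟩ := hCe hzC
      have : x ∈ V i.succ := by rw [← hOV]; exact hFO i hz
      simpa using hVU _ this) (by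
      intro z
      by_cases hz : z ∈ C
      · obtain ⟨x, rfl⟩ := hCe hz
        refine le_trans ?_ (hVK x)
        refine Set.encard_le_encard_of_injOn (f := Fin.succ) (fun i hi => ?_)
          (Fin.succ_injective _).injOn
        rw [mem_ofPred_eq, ← hOV]
        exact hFO i hi.1
      · simp [hz])
  refine ⟨s, W, hWo, fun z hz => ?_, fun i x hx y hy => ?_, hWK⟩
  · obtain ⟨i, hi⟩ := mem_iUnion.1 (hCF hz)
    exact mem_iUnion.2 ⟨i, hFW i ⟨hi, hz⟩⟩
  · have h1 := Metric.mem_ball.1 (hWU i hx)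
    have h2 := Metric.mem_ball'.1 (hWU i hy)
    linarith [dist_triangle x (c i) y]

theorem coverOrderLE_iff_smallCover {T Z : Type*} [TopologicalSpace T] [MetricSpace Z] {K : ℕ}
    {e : T → Z} (he : IsInducing e) {C : ℕ → Set Z} (hC : ∀ j, IsCompact (C j))
    (hCe : range e = ⋃ j, C j) :
    CoverOrderLE T K ↔ ∀ j, ∀ ε > 0, SmallCover (C j) ε K := by
  constructor
  · exact fun h j ε hε => h.smallCover he (hC j) (hCe ▸ subset_iUnion C j) hε
  · intro h
    have := he.pseudoMetrizableSpace
    refine coverOrderLE_of_iUnion_closed (fun j => e ⁻¹' C j)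
      (fun j => (hC j).isClosed.preimage he.continuous)
      (by rw [← preimage_iUnion, ← hCe, preimage_range]) fun j => ?_
    have : CompactSpace (e ⁻¹' C j) := isCompact_iff_compactSpace.1
      (he.isCompact_preimage' (hC j) (hCe ▸ subset_iUnion C j))
    refine coverOrderLE_of_smallCover (he.comp IsInducing.subtypeVal) fun ε hε =>
      (h j ε hε).mono ?_
    rintro _ ⟨x, rfl⟩
    exact x.2

/-! ### Small covers of sets of small Hausdorff dimension -/

theorem SmallCover.of_image {Z Z' : Type*} [PseudoMetricSpace Z] [PseudoMetricSpace Z'] {C : Set Z}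
    {ε L : ℝ} {K : ℕ} {g : Z → Z'} (hg : Continuous g) (hL : 0 < L)
    (hgL : ∀ x y, dist x y ≤ L * dist (g x) (g y)) (h : SmallCover (g '' C) ε K) :
    SmallCover C (L * ε) K := by
  obtain ⟨s, W, hW, hCW, hWd, hWK⟩ := h
  refine ⟨s, fun i => g ⁻¹' W i, fun i => (hW i).preimage hg, ?_, fun i x hx y hy => ?_,
    fun x => hWK (g x)⟩
  · rw [← preimage_iUnion]
    exact image_subset_iff.1 hCW
  · exact (hgL x y).trans_lt (mul_lt_mul_of_pos_left (hWd i _ hx _ hy) hL)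

/-- The open neighbourhood, in the cubical decomposition of `ℝ^N` given by the integer lattice, of
the open face whose points have the coordinates in `S` equal to those of `p` and the other
coordinates in the unit intervals starting at those of `p`. -/
def faceNhd {N : ℕ} (S : Finset (Fin N)) (p : Fin N → ℤ) : Set (Fin N → ℝ) :=
  {x | (∀ c ∈ S, |x c - p c| < 1 / 2) ∧ (∀ c ∉ S, (p c : ℝ) < x c ∧ x c < p c + 1) ∧
    ∀ c ∈ S, ∀ c' ∉ S, |x c - p c| < x c' - p c' ∧ |x c - p c| < p c' + 1 - x c'}

theorem isOpen_faceNhd {N : ℕ} (S : Finset (Fin N)) (p : Fin N → ℤ) : IsOpen (faceNhd S p) := by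
  have h : faceNhd S p = (⋂ c ∈ S, {x : Fin N → ℝ | |x c - p c| < 1 / 2}) ∩
      ((⋂ c ∈ Sᶜ, {x : Fin N → ℝ | (p c : ℝ) < x c} ∩ {x | x c < p c + 1}) ∩
      ⋂ c ∈ S, ⋂ c' ∈ Sᶜ, {x : Fin N → ℝ | |x c - p c| < x c' - p c'} ∩
        {x | |x c - p c| < p c' + 1 - x c'}) := by
    ext x
    simp [faceNhd]
  rw [h]
  refine IsOpen.inter ?_ (IsOpen.inter ?_ ?_)
  · exact isOpen_biInter_finset fun c _ => isOpen_lt (by fun_prop) (by fun_prop)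
  · exact isOpen_biInter_finset fun c _ =>
      (isOpen_lt (by fun_prop) (by fun_prop)).inter (isOpen_lt (by fun_prop) (by fun_prop))
  · exact isOpen_biInter_finset fun c _ => isOpen_biInter_finset fun c' _ =>
      (isOpen_lt (by fun_prop) (by fun_prop)).inter (isOpen_lt (by fun_prop) (by fun_prop))

theorem dist_lt_one_of_mem_faceNhd {N : ℕ} {S : Finset (Fin N)} {p : Fin N → ℤ} {x y : Fin N → ℝ}
    (hx : x ∈ faceNhd S p) (hy : y ∈ faceNhd S p) : dist x y < 1 := by
  rw [dist_pi_lt_iff one_pos]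
  intro c
  rw [Real.dist_eq, abs_lt]
  by_cases hc : c ∈ S
  · have h1 := abs_lt.1 (hx.1 c hc)
    have h2 := abs_lt.1 (hy.1 c hc)
    constructor <;> linarith
  · have h1 := hx.2.1 c hc
    have h2 := hy.2.1 c hc
    constructor <;> linarith

/-- Coordinates in `S` are strictly closer to the lattice than those outside `S`. For distinct sets
of the same size, a coordinate in each difference would give two opposite strict inequalities. Thus
neighbourhoods of faces of equal dimension are disjoint. -/
theorem eq_of_mem_faceNhd {N : ℕ} {S S' : Finset (Fin N)} {p p' : Fin N → ℤ} {x : Fin N → ℝ}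
    (hx : x ∈ faceNhd S p) (hx' : x ∈ faceNhd S' p') (hS : S.card = S'.card) :
    S = S' ∧ p = p' := by
  have hSS : S = S' := by
    by_contra hne
    have h1 : ¬ S ⊆ S' := fun h => hne (Finset.eq_of_subset_of_card_le h hS.ge)
    have h2 : ¬ S' ⊆ S := fun h => hne (Finset.eq_of_subset_of_card_le h hS.le).symm
    obtain ⟨c, hc, hc'⟩ := Finset.not_subset.1 h1
    obtain ⟨b, hb, hb'⟩ := Finset.not_subset.1 h2
    have key : ∀ (q : ℤ) (y δ : ℝ) (r : ℤ), δ < y - q → δ < q + 1 - y → δ < |y - r| := by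
      intro q y δ r hq hq'
      rcases le_or_gt r q with h | h
      · have : (r : ℝ) ≤ q := by exact_mod_cast h
        exact (by linarith : δ < y - r).trans_le (le_abs_self _)
      · have : (q : ℝ) + 1 ≤ r := by exact_mod_cast h
        exact (by linarith : δ < -(y - r)).trans_le (neg_le_abs _)
    have h3 := hx.2.2 c hc b hb'
    have h4 := hx'.2.2 b hb c hc'
    have h5 := key (p b) (x b) _ (p' b) h3.1 h3.2
    have h6 := key (p' c) (x c) _ (p c) h4.1 h4.2
    linarith
  subst hSS
  refine ⟨rfl, funext fun c => ?_⟩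
  by_cases hc : c ∈ S
  · have h1 := abs_lt.1 (hx.1 c hc)
    have h2 := abs_lt.1 (hx'.1 c hc)
    have h3 : (p c : ℝ) < p' c + 1 := by linarith
    have h4 : (p' c : ℝ) < p c + 1 := by linarith
    have h3' : p c < p' c + 1 := by exact_mod_cast h3
    have h4' : p' c < p c + 1 := by exact_mod_cast h4
    omega
  · have h1 := hx.2.1 c hc
    have h2 := hx'.2.1 c hc
    have h3 : (p c : ℝ) < p' c + 1 := by linarith
    have h4 : (p' c : ℝ) < p c + 1 := by linarith
    have h3' : p c < p' c + 1 := by exact_mod_cast h3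
    have h4' : p' c < p c + 1 := by exact_mod_cast h4
    omega

/-- A bounded subset of `ℝ^N` all of whose points have fewer than `K` integer coordinates has
covers of order at most `K` by sets of diameter less than one. -/
theorem smallCover_of_ncard_int_lt {N K : ℕ} {C : Set (Fin N → ℝ)} (hC : Bornology.IsBounded C)
    (h : ∀ x ∈ C, {c | ∃ n : ℤ, x c = n}.ncard < K) : SmallCover C 1 K := by
  classical
  obtain ⟨R, hR⟩ := hC.subset_closedBall 0
  obtain ⟨M, hM⟩ := exists_nat_gt R
  let I : Type := {S : Finset (Fin N) // S.card < K} ×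
    (Fin N → {n : ℤ // n ∈ Finset.Icc (-(M : ℤ) - 1) M})
  refine SmallCover.of_finite (ι := I) (fun i => faceNhd i.1.1 fun c => (i.2 c : ℤ))
    (fun i => isOpen_faceNhd _ _) (fun x hx => ?_)
    (fun i x hx y hy => dist_lt_one_of_mem_faceNhd hx hy) fun x => ?_
  · have hxM : ∀ c, -(M : ℝ) < x c ∧ x c < M := fun c => by
      have h1 := (norm_le_pi_norm x c).trans (mem_closedBall_zero_iff.1 (hR hx))
      rw [Real.norm_eq_abs] at h1
      exact abs_lt.1 (h1.trans_lt hM)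
    let S : Finset (Fin N) := {c | ∃ n : ℤ, x c = n}
    have hS : S.card < K := by
      have := h x hx
      have hS : {c | ∃ n : ℤ, x c = n} = (S : Set (Fin N)) := by
        ext c
        simp [S]
      rwa [hS, Set.ncard_coe_finset] at this
    refine mem_iUnion.2 ⟨(⟨S, hS⟩, fun c => ⟨⌊x c⌋, ?_⟩), ?_, ?_, ?_⟩
    · rw [Finset.mem_Icc]
      constructor
      · rw [Int.le_floor]
        push_cast
        linarith [(hxM c).1]
      · rw [← Int.cast_le (R := ℝ)]
        exact (Int.floor_le _).trans (by exact_mod_cast (hxM c).2.le)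
    · intro c hc
      obtain ⟨n, hn⟩ : ∃ n : ℤ, x c = n := by simpa [S] using hc
      simp [hn]
    · intro c hc
      have hc' : ∀ n : ℤ, x c ≠ n := by simpa [S] using hc
      exact ⟨lt_of_le_of_ne (Int.floor_le _) (hc' _).symm, Int.lt_floor_add_one _⟩
    · intro c hc b hb
      obtain ⟨n, hn⟩ : ∃ n : ℤ, x c = n := by simpa [S] using hc
      have hc' : ∀ n : ℤ, x b ≠ n := by simpa [S] using hb
      have h1 := lt_of_le_of_ne (Int.floor_le (x b)) (hc' _).symm
      have h2 := Int.lt_floor_add_one (x b)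
      simp only [hn, Int.floor_intCast, sub_self, abs_zero]
      constructor <;> linarith
  · have h1 : {i : I | x ∈ faceNhd i.1.1 fun c => (i.2 c : ℤ)}.encard ≤
        (Finset.range K : Set ℕ).encard := by
      -- At most one neighbourhood for each codimension contains `x`, and only codimensions below
      -- `K` occur.
      refine Set.encard_le_encard_of_injOn (f := fun i => i.1.1.card)
        (fun i _ => by simpa using i.1.2) fun i hi j hj hij => ?_
      obtain ⟨h1, h2⟩ := eq_of_mem_faceNhd hi hj hij
      refine Prod.ext (Subtype.ext h1) (funext fun c => Subtype.ext (congrFun h2 c))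
    refine h1.trans ?_
    rw [Set.encard_coe_eq_coe_finsetCard, Finset.card_range]

/-- After a suitable translation, every point of a set of Hausdorff dimension less than `K` has
fewer than `K` coordinates in the lattice of mesh `r`. -/
theorem exists_translate_ncard_lattice_lt {N K : ℕ} {C : Set (Fin N → ℝ)} (h : dimH C < K)
    (r : ℝ) : ∃ t : Fin N → ℝ, ∀ x ∈ C, {c | ∃ n : ℤ, x c - t c = r * n}.ncard < K := by
  classical
  have hnull : ∀ (S : Finset (Fin N)), S.card = K → ∀ p : Fin N → ℤ,
      MeasureTheory.volume {t : Fin N → ℝ | ∃ x ∈ C, ∀ c ∈ S, x c - t c = r * p c} = 0 := by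
    intro S hS p
    -- A translation is bad for `(S, p)` iff its `S`-coordinates lie in `φ '' C`. This Lipschitz
    -- image has dimension less than `K`, so it is null in the `K`-dimensional coordinate space.
    let φ : (Fin N → ℝ) → ({c // c ∈ S} → ℝ) := fun x c => x c - r * p c
    have hφ : LipschitzWith 1 φ := LipschitzWith.of_dist_le_mul fun x y => by
      rw [NNReal.coe_one, one_mul, dist_pi_le_iff dist_nonneg]
      intro c
      simpa [φ] using dist_le_pi_dist x y c
    have h0 : MeasureTheory.volume (φ '' C) = 0 := by
      rw [← MeasureTheory.hausdorffMeasure_pi_real]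
      have : dimH (φ '' C) < ((K : NNReal) : ENNReal) := (hφ.dimH_image_le C).trans_lt (by simpa)
      have := hausdorffMeasure_of_dimH_lt this
      simpa [hS] using this
    have hq : MeasureTheory.Measure.QuasiMeasurePreserving
        (fun (t : Fin N → ℝ) (c : {c // c ∈ S}) => t c) := by
      convert MeasureTheory.Measure.quasiMeasurePreserving_fst.comp
        (MeasureTheory.volume_preserving_piEquivPiSubtypeProd
          (fun _ : Fin N => ℝ) (fun c => c ∈ S)).quasiMeasurePreserving
      all_goals rfl
    refine MeasureTheory.measure_mono_null ?_ (hq.preimage_null h0)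
    rintro t ⟨x, hx, hxt⟩
    refine ⟨x, hx, funext fun c => ?_⟩
    have := hxt c c.2
    simp only [φ]
    linarith
  have hnull' : MeasureTheory.volume (⋃ S : {S : Finset (Fin N) // S.card = K},
      ⋃ p : Fin N → ℤ, {t : Fin N → ℝ | ∃ x ∈ C, ∀ c ∈ S.1, x c - t c = r * p c}) = 0 :=
    MeasureTheory.measure_iUnion_null fun S => MeasureTheory.measure_iUnion_null fun p =>
      hnull S.1 S.2 p
  obtain ⟨t, ht⟩ := (Set.ne_univ_iff_exists_notMem (⋃ S : {S : Finset (Fin N) // S.card = K},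
      ⋃ p : Fin N → ℤ, {t : Fin N → ℝ | ∃ x ∈ C, ∀ c ∈ S.1, x c - t c = r * p c})).1 fun h => by
    rw [h] at hnull'
    exact isOpen_univ.measure_ne_zero _ univ_nonempty hnull'
  refine ⟨t, fun x hx => ?_⟩
  by_contra! hK
  rw [Set.ncard_eq_toFinset_card'] at hK
  obtain ⟨S, hS, hSK⟩ := Finset.exists_subset_card_eq hK
  refine ht (mem_iUnion.2 ⟨⟨S, hSK⟩, ?_⟩)
  have : ∀ c ∈ S, ∃ n : ℤ, x c - t c = r * n := fun c hc => by simpa using hS hc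
  choose! p hp using this
  exact mem_iUnion.2 ⟨p, x, hx, hp⟩

/-- A bounded subset of a finite-dimensional normed space of Hausdorff dimension less than `K` has
arbitrarily fine open covers of order at most `K`. -/
theorem smallCover_of_dimH_lt {Z : Type*} [NormedAddCommGroup Z] [NormedSpace ℝ Z]
    [FiniteDimensional ℝ Z] {C : Set Z} (hC : Bornology.IsBounded C) {K : ℕ} (h : dimH C < K)
    {ε : ℝ} (hε : 0 < ε) : SmallCover C ε K := by
  let e : Z ≃L[ℝ] (Fin (Module.finrank ℝ Z) → ℝ) :=
    ContinuousLinearEquiv.ofFinrankEq (by simp)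
  obtain ⟨L, hL, heL⟩ : ∃ L > 0, ∀ x y, dist x y ≤ L * dist (e x) (e y) := by
    refine ⟨‖(e.symm : (Fin (Module.finrank ℝ Z) → ℝ) →L[ℝ] Z)‖ + 1, by positivity, fun x y => ?_⟩
    have := (e.symm : (Fin (Module.finrank ℝ Z) → ℝ) →L[ℝ] Z).le_opNorm (e x - e y)
    rw [dist_eq_norm, dist_eq_norm]
    simp only [map_sub, ContinuousLinearEquiv.coe_coe, ContinuousLinearEquiv.symm_apply_apply]
      at this
    nlinarith [norm_nonneg (e x - e y)]
  have hr : 0 < ε / L := by positivity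
  have hd : dimH (e '' C) < K := by rwa [e.dimH_image]
  obtain ⟨t, ht⟩ := exists_translate_ncard_lattice_lt hd (ε / L)
  let g : Z → (Fin (Module.finrank ℝ Z) → ℝ) := fun x => (ε / L)⁻¹ • (e x - t)
  have hg : Continuous g := by fun_prop
  have hgL : ∀ x y, dist x y ≤ ε * dist (g x) (g y) := fun x y => by
    refine (heL x y).trans_eq ?_
    simp only [g]
    rw [dist_smul₀, dist_sub_right, Real.norm_of_nonneg (by positivity)]
    field_simp
  have hb : Bornology.IsBounded (g '' C) := by
    have h1 := (hC.image (e : Z →L[ℝ] _)).sub (Bornology.isBounded_singleton (x := t))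
    refine (h1.smul₀ (ε / L)⁻¹).subset ?_
    rintro _ ⟨x, hx, rfl⟩
    exact Set.smul_mem_smul_set (Set.sub_mem_sub (mem_image_of_mem _ hx) rfl)
  have := SmallCover.of_image hg hε hgL (smallCover_of_ncard_int_lt (K := K) hb ?_)
  · rwa [mul_one] at this
  · rintro _ ⟨x, hx, rfl⟩
    refine lt_of_le_of_lt (Set.ncard_le_ncard ?_ (toFinite _)) (ht _ (mem_image_of_mem e hx))
    rintro c ⟨n, hn⟩
    refine ⟨n, ?_⟩
    simp only [g, Pi.smul_apply, Pi.sub_apply, smul_eq_mul] at hn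
    rw [← hn]
    field_simp

/-! ### The source limitation topology -/

/-- The source limitation topology of `C(X, E)` for complete `E` has the Baire property. -/
theorem sourceLimitation_baire {X E : Type*} [TopologicalSpace X] [PseudoMetricSpace E]
    [CompleteSpace E] (G : ℕ → Set C(X, E))
    (ho : ∀ i, ∀ g ∈ G i, ∃ α : C(X, ℝ), (∀ x, 0 < α x) ∧
      ∀ h : C(X, E), (∀ x, dist (g x) (h x) < α x) → h ∈ G i)
    (hd : ∀ i, ∀ (g : C(X, E)) (α : C(X, ℝ)), (∀ x, 0 < α x) →
      ∃ h ∈ G i, ∀ x, dist (g x) (h x) < α x)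
    (g : C(X, E)) (α : C(X, ℝ)) (hα : ∀ x, 0 < α x) :
    ∃ h ∈ ⋂ i, G i, ∀ x, dist (g x) (h x) < α x := by
  -- A move by at most half the radius followed by a quarter of the radius keeps the new closed ball
  -- inside the old one, since `1/2 + 1/4 ≤ 1`.
  have step : ∀ (i : ℕ) (p : {p : C(X, E) × C(X, ℝ) // ∀ x, 0 < p.2 x}),
      ∃ q : {p : C(X, E) × C(X, ℝ) // ∀ x, 0 < p.2 x},
        (∀ x, dist (p.1.1 x) (q.1.1 x) ≤ p.1.2 x / 2) ∧ (∀ x, q.1.2 x ≤ p.1.2 x / 4) ∧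
        ∀ h : C(X, E), (∀ x, dist (q.1.1 x) (h x) ≤ q.1.2 x) → h ∈ G i := by
    rintro i ⟨⟨u, β⟩, hβ⟩
    obtain ⟨v, hv, huv⟩ := hd i u ((1 / 2 : ℝ) • β) fun x => by
      have := hβ x
      simp only [ContinuousMap.smul_apply, smul_eq_mul]
      positivity
    obtain ⟨γ, hγ, hγG⟩ := ho i v hv
    refine ⟨⟨⟨v, ((1 / 2 : ℝ) • γ) ⊓ ((1 / 4 : ℝ) • β)⟩, fun x => ?_⟩, fun x => ?_, fun x => ?_,
      fun h hh => hγG h fun x => ?_⟩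
    · have := hβ x
      have := hγ x
      simp only [ContinuousMap.inf_apply, ContinuousMap.smul_apply, smul_eq_mul, lt_inf_iff]
      constructor <;> positivity
    · have := huv x
      simp only [ContinuousMap.smul_apply, smul_eq_mul] at this
      dsimp only
      linarith
    · simp only [ContinuousMap.inf_apply, ContinuousMap.smul_apply, smul_eq_mul]
      exact inf_le_right.trans_eq (by ring)
    · have h1 := hh x
      have := hγ x
      simp only [ContinuousMap.inf_apply, ContinuousMap.smul_apply, smul_eq_mul, le_inf_iff] at h1
      linarith [h1.1]
  choose S hS1 hS2 hS3 using step
  -- Capping the first radius at `1` bounds the `i`-th radius by `(1/4) ^ i` uniformly in `x`, so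
  -- the limit is continuous.
  let p : ℕ → {p : C(X, E) × C(X, ℝ) // ∀ x, 0 < p.2 x} := fun j =>
    Nat.rec ⟨⟨g, ((1 / 2 : ℝ) • α) ⊓ 1⟩, fun x => by
      have := hα x
      simp only [ContinuousMap.inf_apply, ContinuousMap.smul_apply, smul_eq_mul, lt_inf_iff,
        ContinuousMap.one_apply]
      constructor <;> positivity⟩ (fun j q => S j q) j
  have hp1 : ∀ i x, dist ((p i).1.1 x) ((p (i + 1)).1.1 x) ≤ (p i).1.2 x / 2 :=
    fun i x => hS1 i (p i) x
  have hp2 : ∀ i x, (p (i + 1)).1.2 x ≤ (p i).1.2 x / 4 := fun i x => hS2 i (p i) x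
  have hpos : ∀ i x, 0 < (p i).1.2 x := fun i => (p i).2
  have hdist : ∀ i k x, dist ((p i).1.1 x) ((p (i + k)).1.1 x) + (p (i + k)).1.2 x ≤
      (p i).1.2 x := by
    intro i k x
    induction k with
    | zero => simp
    | succ k ih =>
      have h1 := dist_triangle ((p i).1.1 x) ((p (i + k)).1.1 x) ((p (i + k + 1)).1.1 x)
      have h2 := hp1 (i + k) x
      have h3 := hp2 (i + k) x
      have h4 := hpos (i + k) x
      rw [← add_assoc]
      linarith
  have hdist' : ∀ i j x, i ≤ j → dist ((p i).1.1 x) ((p j).1.1 x) ≤ (p i).1.2 x := by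
    intro i j x hij
    obtain ⟨k, rfl⟩ := Nat.exists_eq_add_of_le hij
    linarith [hdist i k x, hpos (i + k) x]
  have hsmall : ∀ i x, (p i).1.2 x ≤ (1 / 4 : ℝ) ^ i := by
    intro i x
    induction i with
    | zero => simp [p]
    | succ i ih => rw [pow_succ]; linarith [hp2 i x]
  have hlim0 : Filter.Tendsto (fun i : ℕ => (1 / 4 : ℝ) ^ i) Filter.atTop (𝓝 0) :=
    tendsto_pow_atTop_nhds_zero_of_lt_one (by norm_num) (by norm_num)
  have hcauchy : ∀ x, ∃ l, Filter.Tendsto (fun i => (p i).1.1 x) Filter.atTop (𝓝 l) := fun x =>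
    cauchySeq_tendsto_of_complete (cauchySeq_of_le_tendsto_0' (fun i : ℕ => (1 / 4 : ℝ) ^ i)
      (fun i j hij => (hdist' i j x hij).trans (hsmall i x)) hlim0)
  choose h hh using hcauchy
  have hle : ∀ i x, dist ((p i).1.1 x) (h x) ≤ (p i).1.2 x := fun i x =>
    le_of_tendsto (tendsto_const_nhds.dist (hh x))
      (Filter.eventually_atTop.2 ⟨i, fun j hj => hdist' i j x hj⟩)
  have hunif : TendstoUniformly (fun i x => (p i).1.1 x) h Filter.atTop := by
    rw [Metric.tendstoUniformly_iff]
    intro ε hε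
    filter_upwards [hlim0.eventually (gt_mem_nhds hε)] with i hi x
    rw [dist_comm]
    exact ((hle i x).trans (hsmall i x)).trans_lt hi
  have hcont : Continuous h := hunif.continuous
    (Filter.Frequently.of_forall fun i => (p i).1.1.continuous)
  refine ⟨⟨h, hcont⟩, mem_iInter.2 fun i => hS3 i (p i) ⟨h, hcont⟩ fun x => hle (i + 1) x,
    fun x => ?_⟩
  have h1 := hle 0 x
  have h2 : (p 0).1.2 x ≤ (1 / 2 : ℝ) * α x := inf_le_left
  have h3 := hα x
  have h4 : (p 0).1.1 x = g x := rfl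
  rw [h4] at h1
  change dist (g x) (h x) < α x
  linarith

theorem isDenseGdeltaSourceLimitation_iInter {X E : Type*} [TopologicalSpace X]
    [PseudoMetricSpace E] [CompleteSpace E] (G : ℕ → Set C(X, E))
    (ho : ∀ i, ∀ g ∈ G i, ∃ α : C(X, ℝ), (∀ x, 0 < α x) ∧
      ∀ h : C(X, E), (∀ x, dist (g x) (h x) < α x) → h ∈ G i)
    (hd : ∀ i, ∀ (g : C(X, E)) (α : C(X, ℝ)), (∀ x, 0 < α x) →
      ∃ h ∈ G i, ∀ x, dist (g x) (h x) < α x) :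
    IsDenseGdeltaSourceLimitation (⋂ i, G i) := by
  let _ := sourceLimitationTopology X E
  refine ⟨dense_iff_inter_open.2 ?_, .iInter_of_isOpen fun i => ho i⟩
  rintro U hU ⟨g, hg⟩
  obtain ⟨α, hα, hαU⟩ := hU g hg
  obtain ⟨h, hh, hgh⟩ := sourceLimitation_baire G ho hd g α hα
  exact ⟨h, hαU h hgh, hh⟩

/-! ### Zero-dimensional base spaces -/

/-- A shrinking of order one of the cover by `U` and `Aᶜ` is a partition into two open sets. -/
theorem CoverOrderLE.exists_isClopen {Y : Type*} [TopologicalSpace Y] (hY : CoverOrderLE Y 1)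
    {A U : Set Y} (hA : IsClosed A) (hU : IsOpen U) (hAU : A ⊆ U) :
    ∃ H, IsClopen H ∧ A ⊆ H ∧ H ⊆ U := by
  obtain ⟨V, hVo, hVU, hVY, hV1⟩ := hY 2 ![U, Aᶜ]
    (by
      intro i
      fin_cases i
      exacts [hU, hA.isOpen_compl])
    (by
      refine eq_univ_of_forall fun y => mem_iUnion.2 ?_
      by_cases hy : y ∈ A
      exacts [⟨0, hAU hy⟩, ⟨1, hy⟩])
  have h1 : V 1 = (V 0)ᶜ := by
    ext y
    constructor
    · intro h1 h0
      have := encard_le_one_iff.1 (hV1 y) 0 1 h0 h1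
      simp at this
    · intro h0
      obtain ⟨i, hi⟩ := mem_iUnion.1 (hVY ▸ mem_univ y : y ∈ ⋃ i, V i)
      fin_cases i
      exacts [absurd hi h0, hi]
  refine ⟨V 0, ⟨isOpen_compl_iff.1 (h1 ▸ hVo 1), hVo 0⟩, fun y hy => ?_, hVU 0⟩
  by_contra h0
  have : y ∈ V 1 := by rwa [h1]
  exact hVU 1 this hy

/-- Every open cover of a zero-dimensional metrizable space has a locally constant choice
function. -/
theorem CoverOrderLE.exists_isLocallyConstant {Y ι : Type*} [TopologicalSpace Y]
    [TopologicalSpace.MetrizableSpace Y] (hY : CoverOrderLE Y 1) (U : ι → Set Y)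
    (hU : ∀ i, IsOpen (U i)) (hUY : ⋃ i, U i = univ) :
    ∃ c : Y → ι, IsLocallyConstant c ∧ ∀ y, y ∈ U (c y) := by
  let _ := TopologicalSpace.metrizableSpaceMetric Y
  obtain ⟨v, hvo, hvY, hvf, hvU⟩ := precise_refinement U hU hUY
  obtain ⟨F, hFY, hFc, hFv⟩ := exists_iUnion_eq_closed_subset hvo (fun x => hvf.point_finite x) hvY
  choose H hH hFH hHv using fun i => hY.exists_isClopen (hFc i) (hvo i) (hFv i)
  have hHf : LocallyFinite H := hvf.subset hHv
  obtain ⟨_, hwf⟩ := exists_wellFoundedLT ι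
  have hne : ∀ y, {i | y ∈ H i}.Nonempty := fun y => by
    obtain ⟨i, hi⟩ := mem_iUnion.1 (hFY ▸ mem_univ y : y ∈ ⋃ i, F i)
    exact ⟨i, hFH i hi⟩
  -- The least index makes the locally finite clopen cover disjoint; each fibre of `c` is `H i`
  -- minus a locally finite union of clopen sets, hence open.
  let c : Y → ι := fun y => wellFounded_lt.min {i | y ∈ H i} (hne y)
  have hc : ∀ y, y ∈ H (c y) := fun y => wellFounded_lt.min_mem _ (hne y)
  refine ⟨c, (IsLocallyConstant.iff_isOpen_fiber).2 fun i => ?_, fun y => hvU _ (hHv _ (hc y))⟩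
  have : c ⁻¹' {i} = H i ∩ (⋃ j : {j // j < i}, H j)ᶜ := by
    ext x
    constructor
    · rintro rfl
      refine ⟨hc x, fun h => ?_⟩
      obtain ⟨⟨j, hj⟩, hx⟩ := mem_iUnion.1 h
      exact wellFounded_lt.not_lt_min {i | x ∈ H i} hx hj
    · rintro ⟨hx, hx'⟩
      refine le_antisymm (not_lt.1 fun h => wellFounded_lt.not_lt_min {i | x ∈ H i} hx h)
        (not_lt.1 fun h => hx' (mem_iUnion.2 ⟨⟨c x, h⟩, hc x⟩))
  rw [this]
  exact (hH i).isOpen.inter ((hHf.comp_injective Subtype.val_injective).isClosed_iUnion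
    fun j => (hH j.1).isClosed).isOpen_compl

/-- Over a zero-dimensional base, a property of the restrictions of a map to the fibres of a proper
map `f` that is stable under small perturbations and can be achieved on each fibre by a small
perturbation defines an open dense set for the source limitation topology. -/
theorem sourceLimitation_open_dense_of_fiberwise {X Y E : Type*} [TopologicalSpace X]
    [TopologicalSpace Y] [TopologicalSpace.MetrizableSpace Y] [PseudoMetricSpace E] {f : X → Y}
    (hf : IsProperMap f) (hY : CoverOrderLE Y 1) (P : C(X, E) → Y → Prop)
    (hstable : ∀ g y, P g y → ∃ O ∈ 𝓝 y, ∃ η > 0, ∀ (h : C(X, E)), ∀ y' ∈ O,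
      (∀ x, f x = y' → dist (g x) (h x) < η) → P h y')
    (happrox : ∀ (g : C(X, E)) y, ∀ ε > 0, ∃ h : C(X, E),
      (∀ x, f x = y → dist (g x) (h x) < ε) ∧ P h y) :
    (∀ g ∈ {g | ∀ y, P g y}, ∃ α : C(X, ℝ), (∀ x, 0 < α x) ∧
      ∀ h : C(X, E), (∀ x, dist (g x) (h x) < α x) → h ∈ {g | ∀ y, P g y}) ∧
    ∀ (g : C(X, E)) (α : C(X, ℝ)), (∀ x, 0 < α x) →
      ∃ h ∈ {g | ∀ y, P g y}, ∀ x, dist (g x) (h x) < α x := by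
  constructor
  · intro g hg
    choose O hO η hη hP using fun y => hstable g y (hg y)
    obtain ⟨c, hc, hcO⟩ := hY.exists_isLocallyConstant (fun y => interior (O y))
      (fun y => isOpen_interior)
      (eq_univ_of_forall fun y => mem_iUnion.2 ⟨y, mem_interior_iff_mem_nhds.2 (hO y)⟩)
    refine ⟨⟨fun x => η (c (f x)), (hc.comp η).continuous.comp hf.continuous⟩, fun x => hη _,
      fun h hh y => hP (c y) h y (interior_subset (hcO y)) ?_⟩
    rintro x rfl
    exact hh x
  · intro g α hα
    have hloc : ∀ y, ∃ h : C(X, E), ∃ O ∈ 𝓝 y, (∀ x, f x ∈ O → dist (g x) (h x) < α x) ∧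
        ∀ y' ∈ O, P h y' := by
      intro y
      have hK : IsCompact (f ⁻¹' {y}) := hf.isCompact_preimage isCompact_singleton
      obtain ⟨ε, hε, hεα⟩ : ∃ ε > 0, ∀ x, f x = y → ε ≤ α x := by
        rcases (f ⁻¹' {y}).eq_empty_or_nonempty with h | h
        · exact ⟨1, one_pos, fun x hx => absurd (show x ∈ f ⁻¹' {y} from hx) (h ▸ notMem_empty x)⟩
        · obtain ⟨x₀, hx₀, hmin⟩ := hK.exists_isMinOn h α.continuous.continuousOn
          exact ⟨α x₀, hα x₀, fun x hx => hmin hx⟩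
      obtain ⟨h, hgh, hPh⟩ := happrox g y ε hε
      obtain ⟨O, hO, η, hη, hOP⟩ := hstable h y hPh
      have hA : IsOpen {x | dist (g x) (h x) < α x} := isOpen_lt (by fun_prop) (by fun_prop)
      -- Tube argument: since `f` is closed, the estimate on the fibre over `y` holds over a whole
      -- neighbourhood of `y`.
      have hO' : (f '' {x | dist (g x) (h x) < α x}ᶜ)ᶜ ∈ 𝓝 y := by
        refine (hf.isClosedMap _ hA.isClosed_compl).isOpen_compl.mem_nhds ?_
        rintro ⟨x, hx, hxy⟩
        exact hx ((hgh x hxy).trans_le (hεα x hxy))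
      refine ⟨h, _, Filter.inter_mem hO hO', fun x hx => ?_, fun y' hy' => hOP h y' hy'.1 ?_⟩
      · by_contra hx'
        exact hx.2 ⟨x, hx', rfl⟩
      · exact fun x _ => by simpa using hη
    choose H O hO hgH hPH using hloc
    obtain ⟨c, hc, hcO⟩ := hY.exists_isLocallyConstant (fun y => interior (O y))
      (fun y => isOpen_interior)
      (eq_univ_of_forall fun y => mem_iUnion.2 ⟨y, mem_interior_iff_mem_nhds.2 (hO y)⟩)
    have hcont : Continuous fun x => H (c (f x)) x := by
      rw [continuous_iff_continuousAt]
      intro x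
      have h1 : ∀ᶠ x' in 𝓝 x, c (f x') = c (f x) :=
        hf.continuous.continuousAt.eventually (hc.eventually_eq (f x))
      exact (H (c (f x))).continuous.continuousAt.congr (h1.mono fun x' hx' => by
        change _ = H (c (f x')) x'
        rw [hx'])
    refine ⟨⟨_, hcont⟩, fun y => ?_, fun x => hgH _ x (interior_subset (hcO (f x)))⟩
    -- Stability is used here with zero perturbation: the glued map equals `H (c y)` on the fibre
    -- over `y`, and `P` at `y` depends only on that fibre.
    obtain ⟨O', hO', η, hη, hP⟩ := hstable (H (c y)) y (hPH _ y (interior_subset (hcO y)))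
    refine hP _ y (mem_of_mem_nhds hO') ?_
    rintro x rfl
    simpa using hη

/-! ### Planes as points of a normed space -/

/-- Euclidean space `ℝ^m`. -/
abbrev Euc (m : ℕ) : Type := EuclideanSpace ℝ (Fin m)

/-- The normed space containing the affine Grassmannians of `ℝ^m`. -/
abbrev PlaneSpace (m : ℕ) : Type := Euc m × (Euc m →L[ℝ] Euc m)

theorem starProjection_congr {m : ℕ} {U V : Submodule ℝ (Euc m)} (h : U = V) :
    U.starProjection = V.starProjection := by
  subst h; rfl

namespace AffinePlane

variable {m d : ℕ}

/-- The embedding of the space of `d`-planes that defines its topology. -/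
noncomputable def emb (P : AffinePlane m d) : PlaneSpace m := (P.foot, P.directionProj)

theorem isInducing_emb : IsInducing (emb : AffinePlane m d → PlaneSpace m) := ⟨rfl⟩

theorem directionProj_foot (P : AffinePlane m d) :
    P.foot ∈ P.1 ∧ P.directionProj P.foot = 0 := by
  have : Nonempty P.1 := P.2.1.to_subtype
  have h := (EuclideanGeometry.coe_orthogonalProjection_eq_iff_mem (s := P.1)
    (p := (0 : Euc m)) (q := P.foot)).1 rfl
  refine ⟨h.1, ?_⟩
  have h2 : P.foot ∈ P.1.directionᗮ := by simpa using h.2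
  exact (Submodule.starProjection_apply_eq_zero_iff _).2 h2

theorem mem_points_iff (P : AffinePlane m d) (x : Euc m) :
    x ∈ P.points ↔ P.directionProj x = x - P.foot := by
  obtain ⟨h1, h2⟩ := P.directionProj_foot
  have h3 : x ∈ P.points ↔ x - P.foot ∈ P.1.direction :=
    (AffineSubspace.vsub_right_mem_direction_iff_mem h1 x).symm
  rw [h3, ← Submodule.starProjection_eq_self_iff, map_sub]
  change P.directionProj x - P.directionProj P.foot = _ ↔ _
  rw [h2, sub_zero]

end AffinePlane

/-- The incidence relation between the points and the `d`-planes of `ℝ^m`. -/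
def incidence (m d : ℕ) : Set (Euc m × PlaneSpace m) :=
  {p | IsStarProjection p.2.2 ∧ LinearMap.trace ℝ (Euc m) p.2.2 = d ∧ p.2.2 p.1 = p.1 - p.2.1}

theorem isClosed_incidence (m d : ℕ) : IsClosed (incidence m d) := by
  have htr : Continuous fun A : Euc m →L[ℝ] Euc m => LinearMap.trace ℝ (Euc m) A :=
    LinearMap.continuous_of_finiteDimensional
      (LinearMap.trace ℝ (Euc m) ∘ₗ ContinuousLinearMap.coeLM ℝ)
  have h : incidence m d = ({p | p.2.2 * p.2.2 = p.2.2} ∩ {p | star p.2.2 = p.2.2}) ∩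
      ({p | LinearMap.trace ℝ (Euc m) p.2.2 = d} ∩ {p | p.2.2 p.1 = p.1 - p.2.1}) := by
    ext p
    simp only [incidence, isStarProjection_iff, IsIdempotentElem, isSelfAdjoint_iff, mem_inter_iff,
      mem_ofPred_eq]
  rw [h]
  refine ((isClosed_eq ?_ ?_).inter (isClosed_eq ?_ ?_)).inter
    ((isClosed_eq ?_ ?_).inter (isClosed_eq ?_ ?_))
  · exact (continuous_snd.comp continuous_snd).mul (continuous_snd.comp continuous_snd)
  · exact continuous_snd.comp continuous_snd
  · exact (ContinuousLinearMap.adjoint (𝕜 := ℝ) (E := Euc m) (F := Euc m)).continuous.comp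
      (continuous_snd.comp continuous_snd)
  · exact continuous_snd.comp continuous_snd
  · exact htr.comp (continuous_snd.comp continuous_snd)
  · exact continuous_const
  · exact (continuous_snd.comp continuous_snd).clm_apply continuous_fst
  · exact continuous_fst.sub (continuous_fst.comp continuous_snd)

theorem trace_starProjection {m : ℕ} (U : Submodule ℝ (Euc m)) :
    LinearMap.trace ℝ (Euc m) U.starProjection = Module.finrank ℝ U := by
  refine LinearMap.IsProj.trace ⟨fun x => ?_, fun x hx => ?_⟩
  · exact Submodule.starProjection_apply_mem U x
  · exact Submodule.starProjection_eq_self_iff.2 hx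

theorem emb_mem_incidence {m d : ℕ} {P : AffinePlane m d} {x : Euc m} :
    (x, P.emb) ∈ incidence m d ↔ x ∈ P.points := by
  constructor
  · exact fun h => (P.mem_points_iff x).2 h.2.2
  · refine fun h => ⟨isStarProjection_starProjection, ?_, (P.mem_points_iff x).1 h⟩
    refine (trace_starProjection P.1.direction).trans ?_
    rw [P.2.2]

/-- A star projection of trace `d` projects onto a `d`-dimensional subspace, and having an incident
point forces the first component to be orthogonal to it, hence to be the foot. So the closed
incidence equations describe exactly the embedded planes. -/
theorem exists_emb_of_mem_incidence {m d : ℕ} {x : Euc m} {z : PlaneSpace m}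
    (h : (x, z) ∈ incidence m d) : ∃ P : AffinePlane m d, P.emb = z := by
  obtain ⟨a, A⟩ := z
  obtain ⟨hA, htr, hx⟩ := h
  dsimp only at hA htr hx
  obtain ⟨_, hAU⟩ := isStarProjection_iff_eq_starProjection_range.1 hA
  set U : Submodule ℝ (Euc m) := A.range with hU
  have hd : Module.finrank ℝ U = d := by
    have := trace_starProjection U
    rw [← hAU, htr] at this
    exact_mod_cast this.symm
  let P : AffinePlane m d := ⟨AffineSubspace.mk' a U, ⟨a, AffineSubspace.self_mem_mk' a U⟩, by
    rw [AffineSubspace.direction_mk', hd]⟩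
  have hdir : P.1.direction = U := AffineSubspace.direction_mk' a U
  have hPA : P.directionProj = A := (starProjection_congr hdir).trans hAU.symm
  have hAa : A a = 0 := by
    have h1 : A (A x) = A x := by
      have := hA.isIdempotentElem
      exact DFunLike.congr_fun (this : A * A = A) x
    rw [hx, map_sub, hx] at h1
    simpa using h1
  refine ⟨P, Prod.ext ?_ hPA⟩
  have : Nonempty P.1 := P.2.1.to_subtype
  refine (EuclideanGeometry.coe_orthogonalProjection_eq_iff_mem (s := P.1)).2
    ⟨AffineSubspace.self_mem_mk' a U, ?_⟩
  rw [hdir, ← Submodule.starProjection_apply_eq_zero_iff, ← hAU]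
  simp [hAa]

/-- This bound makes the planes through a bounded set of points bounded, which yields compactness of
`secants`. -/
theorem norm_le_of_mem_incidence {m d : ℕ} {x : Euc m} {z : PlaneSpace m}
    (h : (x, z) ∈ incidence m d) : ‖z‖ ≤ 2 * ‖x‖ + 1 := by
  obtain ⟨a, A⟩ := z
  obtain ⟨hA, -, hx⟩ := h
  dsimp only at hA hx
  obtain ⟨_, hAU⟩ := isStarProjection_iff_eq_starProjection_range.1 hA
  have h1 : ‖A‖ ≤ 1 := by
    rw [hAU]
    exact Submodule.starProjection_norm_le _
  have h2 : ‖A x‖ ≤ ‖x‖ := by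
    simpa using A.le_of_opNorm_le h1 x
  have h3 : a = x - A x := by rw [hx]; simp
  rw [Prod.norm_mk, sup_le_iff]
  constructor
  · rw [h3]
    linarith [norm_sub_le x (A x)]
  · linarith [norm_nonneg x]

/-! ### The planes meeting the image of a set in separated points -/

/-- The `d`-planes that contain the images under `g` of `q` points of `A` with pairwise distances
at least `δ`. -/
def secants (q d : ℕ) {m : ℕ} {X : Type*} [PseudoMetricSpace X] (g : X → Euc m) (A : Set X)
    (δ : ℝ) : Set (PlaneSpace m) :=
  {z | ∃ x : Fin q → X, (∀ a, x a ∈ A) ∧ (∀ a b, a ≠ b → δ ≤ dist (x a) (x b)) ∧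
    ∀ a, (g (x a), z) ∈ incidence m d}

theorem isCompact_secants {q d m : ℕ} (hq : 0 < q) {X : Type*} [PseudoMetricSpace X]
    {g : X → Euc m} (hg : Continuous g) {A : Set X} (hA : IsCompact A) (δ : ℝ) :
    IsCompact (secants q d g A δ) := by
  obtain ⟨R, hR⟩ := (hA.image hg).isBounded.subset_closedBall 0
  have hK : IsCompact ((univ.pi fun _ : Fin q => A) ×ˢ
      Metric.closedBall (0 : PlaneSpace m) (2 * R + 1)) :=
    (isCompact_univ_pi fun _ => hA).prod (isCompact_closedBall _ _)
  have hc : IsClosed {p : (Fin q → X) × PlaneSpace m |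
      (∀ a b, a ≠ b → δ ≤ dist (p.1 a) (p.1 b)) ∧ ∀ a, (g (p.1 a), p.2) ∈ incidence m d} := by
    simp only [ofPred_and, ofPred_forall]
    refine IsClosed.inter (isClosed_iInter fun a => isClosed_iInter fun b => isClosed_iInter
      fun _ => isClosed_le (by fun_prop) (by fun_prop)) (isClosed_iInter fun a =>
        (isClosed_incidence m d).preimage (by fun_prop))
  convert (hK.inter_right hc).image continuous_snd using 1
  ext z
  constructor
  · rintro ⟨x, hx, hd, hi⟩
    refine ⟨(x, z), ⟨⟨fun a _ => hx a, ?_⟩, hd, hi⟩, rfl⟩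
    have h1 := norm_le_of_mem_incidence (hi ⟨0, hq⟩)
    have h2 := mem_closedBall_zero_iff.1 (hR (mem_image_of_mem g (hx ⟨0, hq⟩)))
    rw [mem_closedBall_zero_iff]
    dsimp only
    linarith
  · rintro ⟨⟨x, z⟩, ⟨⟨hx, -⟩, hd, hi⟩, rfl⟩
    exact ⟨x, fun a => hx a trivial, hd, hi⟩

/-- Upper semicontinuity of the set of secant planes of the fibres of a proper map. -/
theorem secants_subset_of_near {q d m : ℕ} (hq : 0 < q) {X Y : Type*} [PseudoMetricSpace X]
    [TopologicalSpace Y] {f : X → Y} (hf : IsProperMap f) {g : X → Euc m} (hg : Continuous g)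
    {δ : ℝ} {y : Y} {W : Set (PlaneSpace m)} (hW : IsOpen W)
    (hgW : secants q d g (f ⁻¹' {y}) δ ⊆ W) :
    ∃ O ∈ 𝓝 y, ∃ η > 0, ∀ h : X → Euc m, ∀ y' ∈ O, (∀ x, f x = y' → dist (g x) (h x) < η) →
      secants q d h (f ⁻¹' {y'}) δ ⊆ W := by
  let τ := (Fin q → X) × (Fin q → Euc m) × PlaneSpace m
  let D : Set τ := {t | (∀ a b, a ≠ b → δ ≤ dist (t.1 a) (t.1 b)) ∧
    (∀ a, (t.2.1 a, t.2.2) ∈ incidence m d) ∧ t.2.2 ∉ W}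
  let Ψ : τ → (Fin q → Y) × (Fin q → ℝ) :=
    fun t => (fun a => f (t.1 a), fun a => dist (g (t.1 a)) (t.2.1 a))
  -- Otherwise some ultrafilter on configurations in `D` converges under `Ψ` to this point.
  -- Properness gives limits of the points in the fibre over `y`, boundedness gives a limit plane,
  -- and the limit is a separated secant of `g` outside `W`.
  have key : ((fun _ => y, 0) : (Fin q → Y) × (Fin q → ℝ)) ∉ closure (Ψ '' D) := by
    intro hcl
    rw [mem_closure_iff_clusterPt, clusterPt_iff_ultrafilter] at hcl
    obtain ⟨u, huD, hu⟩ := hcl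
    rw [Filter.le_principal_iff] at huD
    obtain ⟨v, hv, rfl⟩ : ∃ v : Ultrafilter τ, D ∈ v ∧ v.map Ψ = u := by
      have hne : (Filter.comap Ψ u ⊓ Filter.principal D).NeBot := by
        rw [Filter.inf_principal_neBot_iff]
        intro s hs
        obtain ⟨t, ht, hts⟩ := hs
        obtain ⟨_, hw, p, hp, rfl⟩ := u.neBot.nonempty_of_mem (Filter.inter_mem ht huD)
        exact ⟨p, hts hw, hp⟩
      refine ⟨Ultrafilter.of (Filter.comap Ψ u ⊓ Filter.principal D), ?_, ?_⟩
      · exact (Ultrafilter.of_le _).trans inf_le_right (Filter.mem_principal_self D)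
      · refine Ultrafilter.coe_injective (Ultrafilter.unique _ ?_)
        rw [Ultrafilter.coe_map]
        exact Filter.map_le_iff_le_comap.2 ((Ultrafilter.of_le _).trans inf_le_left)
    have hΨ : Filter.Tendsto Ψ v (𝓝 (fun _ => y, 0)) := hu
    rw [nhds_prod_eq] at hΨ
    have hfy : ∀ a, Filter.Tendsto (fun t : τ => f (t.1 a)) v (𝓝 y) := fun a =>
      (tendsto_pi_nhds.1 (Filter.tendsto_fst.comp hΨ) a)
    have hd0 : ∀ a, Filter.Tendsto (fun t : τ => dist (g (t.1 a)) (t.2.1 a)) v (𝓝 0) := fun a =>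
      (tendsto_pi_nhds.1 (Filter.tendsto_snd.comp hΨ) a)
    have hx : ∀ a, ∃ x, f x = y ∧ Filter.Tendsto (fun t : τ => t.1 a) v (𝓝 x) := fun a =>
      (isProperMap_iff_ultrafilter.1 hf).2 (𝒰 := v.map fun t : τ => t.1 a) (hfy a)
    choose x hxy hx using hx
    have hgx : ∀ a, Filter.Tendsto (fun t : τ => t.2.1 a) v (𝓝 (g (x a))) := fun a =>
      ((hg.tendsto (x a)).comp (hx a)).congr_dist (hd0 a)
    have hDv : ∀ᶠ t in (v : Filter τ), t ∈ D := hv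
    have hbdd : ∀ᶠ t in (v : Filter τ),
        t.2.2 ∈ Metric.closedBall (0 : PlaneSpace m) (2 * (‖g (x ⟨0, hq⟩)‖ + 1) + 1) := by
      filter_upwards [(hgx ⟨0, hq⟩).norm.eventually (gt_mem_nhds (lt_add_one _)), hDv] with t h1 h2
      have := norm_le_of_mem_incidence (h2.2.1 ⟨0, hq⟩)
      rw [mem_closedBall_zero_iff]
      linarith
    obtain ⟨z, -, hz⟩ := (isCompact_closedBall (0 : PlaneSpace m)
      (2 * (‖g (x ⟨0, hq⟩)‖ + 1) + 1)).ultrafilter_le_nhds (v.map fun t : τ => t.2.2)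
      (Filter.le_principal_iff.2 hbdd)
    have hz : Filter.Tendsto (fun t : τ => t.2.2) v (𝓝 z) := hz
    refine hW.isClosed_compl.mem_of_tendsto hz (hDv.mono fun t ht => ht.2.2) (hgW ⟨x, hxy, ?_, ?_⟩)
    · exact fun a b hab => ge_of_tendsto ((hx a).dist (hx b)) (hDv.mono fun t ht => ht.1 a b hab)
    · exact fun a => (isClosed_incidence m d).mem_of_tendsto ((hgx a).prodMk_nhds hz)
        (hDv.mono fun t ht => ht.2.1 a)
  have hnhds := isClosed_closure.isOpen_compl.mem_nhds key
  obtain ⟨u, hu, v, hv, huv⟩ := mem_nhds_prod_iff.1 hnhds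
  obtain ⟨η, hη, hηv⟩ := Metric.mem_nhds_iff.1 hv
  have hcst : Continuous fun (y' : Y) (_ : Fin q) => y' := by fun_prop
  refine ⟨_, hcst.continuousAt hu, η, hη, fun h y' hy' hh z hz => ?_⟩
  obtain ⟨x, hx, hxd, hxi⟩ := hz
  by_contra hzW
  have h1 : Ψ (x, fun a => h (x a), z) ∈ closure (Ψ '' D) :=
    subset_closure ⟨_, ⟨hxd, hxi, hzW⟩, rfl⟩
  refine huv ⟨?_, hηv ?_⟩ h1
  · have : (fun a => f (x a)) = fun _ => y' := funext fun a => hx a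
    simpa [Ψ, this] using hy'
  · rw [mem_ball_zero_iff, pi_norm_lt_iff hη]
    intro a
    simpa [Ψ] using hh (x a) (hx a)

/-- Finitely many distinct points have a positive minimal distance. -/
theorem range_emb_planesHitting {q d m : ℕ} (hq : 0 < q) {X : Type*} [MetricSpace X]
    (g : C(X, Euc m)) (A : Set X) :
    range (fun P : planesHitting q d m (g.restrict A) => P.1.emb) =
      ⋃ j : ℕ, secants q d g A (1 / ((j : ℝ) + 1)) := by
  ext z
  rw [mem_iUnion]
  constructor
  · rintro ⟨⟨P, hP⟩, rfl⟩
    obtain ⟨t, ht, htq⟩ := exists_subset_encard_eq (show (q : ℕ∞) ≤ _ from hP)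
    have htf : t.Finite := finite_of_encard_eq_coe htq
    rw [htf.encard_eq_coe_toFinset_card] at htq
    let e := Finset.equivFinOfCardEq (s := htf.toFinset) (by exact_mod_cast htq)
    let x : Fin q → A := fun a => (e.symm a).1
    have hxt : ∀ a, x a ∈ t := fun a => htf.mem_toFinset.1 (e.symm a).2
    have hxi : Function.Injective x := fun a b h => e.symm.injective (Subtype.ext h)
    have hev : ∀ᶠ j : ℕ in Filter.atTop, ∀ a b, a ≠ b →
        1 / ((j : ℝ) + 1) ≤ dist (x a : X) (x b) := by
      rw [Filter.eventually_all]
      intro a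
      rw [Filter.eventually_all]
      intro b
      by_cases hab : a = b
      · simp [hab]
      · have : 0 < dist (x a : X) (x b) :=
          dist_pos.2 fun h => hab (hxi (Subtype.ext h))
        filter_upwards [tendsto_one_div_add_atTop_nhds_zero_nat.eventually (gt_mem_nhds this)]
          with j hj _ using hj.le
    obtain ⟨j, hj⟩ := hev.exists
    refine ⟨j, fun a => x a, fun a => (x a).2, hj, fun a => ?_⟩
    exact emb_mem_incidence.2 (ht (hxt a))
  · rintro ⟨j, x, hxA, hxd, hxi⟩
    obtain ⟨P, rfl⟩ := exists_emb_of_mem_incidence (hxi ⟨0, hq⟩)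
    refine ⟨⟨P, ?_⟩, rfl⟩
    have h1 : (univ : Set (Fin q)).encard ≤ (g.restrict A ⁻¹' P.points).encard := by
      refine encard_le_encard_of_injOn (f := fun a => (⟨x a, hxA a⟩ : A))
        (fun a _ => emb_mem_incidence.1 (hxi a)) fun a _ b _ hab => ?_
      by_contra hne
      have h2 := hxd a b hne
      rw [show x a = x b from congrArg Subtype.val hab, dist_self] at h2
      exact absurd h2 (not_le.2 (by positivity))
    rw [encard_univ, ENat.card_eq_coe_fintype_card, Fintype.card_fin] at h1
    exact h1

theorem SmallCover.mono_right {Z : Type*} [PseudoMetricSpace Z] {C : Set Z} {ε ε' : ℝ} {K : ℕ}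
    (h : SmallCover C ε K) (hε : ε ≤ ε') : SmallCover C ε' K := by
  obtain ⟨s, W, hW, hCW, hd, hK⟩ := h
  exact ⟨s, W, hW, hCW, fun i x hx y hy => (hd i x hx y hy).trans_le hε, hK⟩

/-- If on each fibre every map has arbitrarily small perturbations whose separated secant planes
have fine covers of order at most `k + 1`, then `fiberwiseDimSet f q d m k` is a dense `G_δ` set. -/
theorem isDenseGdelta_fiberwiseDimSet {X Y : Type*} [MetricSpace X] [TopologicalSpace Y]
    [TopologicalSpace.MetrizableSpace Y] {f : X → Y} (hf : IsProperMap f)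
    (hY : CoverOrderLE Y 1) {q d m : ℕ} (hq : 0 < q) (k : ℤ)
    (happrox : ∀ (g : C(X, Euc m)) (y : Y), ∀ δ > 0, ∀ ε > 0, ∀ η > 0, ∃ h : C(X, Euc m),
      (∀ x, f x = y → dist (g x) (h x) < η) ∧
        SmallCover (secants q d h (f ⁻¹' {y}) δ) ε (k + 1).toNat) :
    IsDenseGdeltaSourceLimitation (fiberwiseDimSet f q d m k) := by
  let P : ℕ → C(X, Euc m) → Y → Prop := fun i g y =>
    SmallCover (secants q d g (f ⁻¹' {y}) (1 / ((i.unpair.1 : ℝ) + 1)))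
      (1 / ((i.unpair.2 : ℝ) + 1)) (k + 1).toNat
  have hP : fiberwiseDimSet f q d m k = ⋂ i, {g | ∀ y, P i g y} := by
    ext g
    simp only [fiberwiseDimSet, mem_ofPred_eq, mem_iInter]
    rw [forall_comm]
    refine forall_congr' fun y => ?_
    have hK : IsCompact (f ⁻¹' {y}) := hf.isCompact_preimage isCompact_singleton
    rw [coveringDimLE_iff_coverOrderLE, coverOrderLE_iff_smallCover
      (AffinePlane.isInducing_emb.comp IsInducing.subtypeVal)
      (fun j : ℕ => isCompact_secants hq g.continuous hK (1 / ((j : ℝ) + 1)))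
      (range_emb_planesHitting hq g _)]
    constructor
    · exact fun h i => h _ _ (by positivity)
    · intro h j ε hε
      obtain ⟨i, hi⟩ := exists_nat_one_div_lt hε
      have := h (Nat.pair j i)
      simp only [P, Nat.unpair_pair] at this
      exact this.mono_right hi.le
  have hG : ∀ i, _ := fun i => sourceLimitation_open_dense_of_fiberwise hf hY (P i)
    (by
      rintro g y ⟨s, W, hW, hCW, hWd⟩
      obtain ⟨O, hO, η, hη, h⟩ :=
        secants_subset_of_near hq hf g.continuous (isOpen_iUnion hW) hCW
      exact ⟨O, hO, η, hη, fun u y' hy' hu => ⟨s, W, hW, h u y' hy' hu, hWd⟩⟩)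
    (fun g y η hη => happrox g y _ (by positivity) _ (by positivity) η hη)
  rw [hP]
  exact isDenseGdeltaSourceLimitation_iInter _ (fun i => (hG i).1) fun i => (hG i).2

/-! ### Polyhedral approximation -/

/-- On a compact set of covering dimension at most `n`, every map to `ℝ^m` can be approximated by
maps into polyhedra of dimension at most `n` with freely movable vertices. -/
theorem exists_polyhedral_approximation {X : Type*} [MetricSpace X] {A : Set X} (hA : IsCompact A)
    {n m : ℕ} (hn : CoverOrderLE A (n + 1)) (g : C(X, Euc m)) {δ η : ℝ} (hδ : 0 < δ)
    (hη : 0 < η) :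
    ∃ (s : ℕ) (v₀ : Fin s → Euc m) (w : A → Fin s → ℝ),
      (∀ x, ∑ i, w x i = 1) ∧ (∀ x, {i | w x i ≠ 0}.encard ≤ n + 1) ∧
      (∀ x x' i, w x i ≠ 0 → w x' i ≠ 0 → dist x x' < δ) ∧
      ∀ v : Fin s → Euc m, (∀ i, dist (v₀ i) (v i) < η / 2) →
        ∃ h : C(X, Euc m), (∀ x ∈ A, dist (g x) (h x) < η) ∧ ∀ x : A, h x = ∑ i, w x i • v i := by
  have : CompactSpace A := isCompact_iff_compactSpace.1 hA
  have huc := CompactSpace.uniformContinuous_of_continuous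
    (g.continuous.comp continuous_subtype_val : Continuous fun x : A => g x)
  obtain ⟨r, hr, hgr⟩ := Metric.uniformContinuous_iff.1 huc (η / 2) (half_pos hη)
  -- Radius `r` controls the oscillation of `g` by `η / 2`, leaving `η / 2` for moving the vertices;
  -- radius at most `δ / 2` keeps points with a common vertex less than `δ` apart.
  let ρ := min r (δ / 2)
  have hρ : 0 < ρ := lt_min hr (half_pos hδ)
  obtain ⟨t, -, htf, htcov⟩ := (isCompact_univ (X := A)).finite_cover_balls hρ
  obtain ⟨s, c, -, rfl⟩ := htf.fin_param
  obtain ⟨V, hVo, hVU, hVA, hVn⟩ := hn s (fun i => Metric.ball (c i) ρ)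
    (fun i => Metric.isOpen_ball) (by simpa [univ_subset_iff] using htcov)
  obtain ⟨φ, hφ⟩ := PartitionOfUnity.exists_isSubordinate isClosed_univ V hVo hVA.ge
  have hφV : ∀ x i, φ i x ≠ 0 → x ∈ V i := fun x i hx =>
    hφ i (subset_closure (Function.mem_support.2 hx))
  have hφ1 : ∀ x, ∑ i, φ i x = 1 := fun x => by
    rw [← finsum_eq_sum_of_fintype]
    exact φ.sum_eq_one (mem_univ x)
  refine ⟨s, fun i => g (c i), fun x i => φ i x, hφ1, fun x => ?_, fun x x' i hx hx' => ?_,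
    fun v hv => ?_⟩
  · exact (encard_le_encard fun i hi => hφV x i hi).trans (by exact_mod_cast hVn x)
  · have h1 := Metric.mem_ball.1 (hVU i (hφV x i hx))
    have h2 := Metric.mem_ball'.1 (hVU i (hφV x' i hx'))
    have h3 : ρ ≤ δ / 2 := min_le_right _ _
    linarith [dist_triangle x (c i) x']
  · have := TietzeExtension.of_tvs ℝ (E := Euc m)
    let h₀ : C(A, Euc m) := ⟨fun x => ∑ i, φ i x • v i, by fun_prop⟩
    obtain ⟨h, hh⟩ := ContinuousMap.exists_restrict_eq hA.isClosed h₀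
    have hhA : ∀ x : A, h x = ∑ i, φ i x • v i := fun x => DFunLike.congr_fun hh x
    refine ⟨h, fun x hx => ?_, hhA⟩
    rw [hhA ⟨x, hx⟩, ← Metric.mem_ball', ← finsum_eq_sum_of_fintype]
    refine φ.finsum_smul_mem_convex (mem_univ _) (g := fun i _ => v i) (fun i hi => ?_)
      (convex_ball _ _)
    have h1 := hgr ((Metric.mem_ball.1 (hVU i (hφV _ i hi))).trans_le (min_le_left _ _))
    rw [Metric.mem_ball']
    change dist (g x) (g (c i)) < η / 2 at h1
    linarith [dist_triangle (g x) (g (c i)) (v i), hv i]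

/-- The `d`-planes that meet the affine span of each of the families `u a`. -/
def planesThrough {q n m : ℕ} (d : ℕ) (u : Fin q → Fin (n + 1) → Euc m) : Set (PlaneSpace m) :=
  {z | ∀ a, ∃ w : Fin (n + 1) → ℝ, ∑ j, w j = 1 ∧ (∑ j, w j • u a j, z) ∈ incidence m d}

theorem smallCover_of_subset_iUnion {Z I : Type*} [NormedAddCommGroup Z] [NormedSpace ℝ Z]
    [FiniteDimensional ℝ Z] [Finite I] {C : Set Z} (hC : Bornology.IsBounded C) {K : ℕ}
    (T : I → Set Z) (hCT : C ⊆ ⋃ i, T i) (hT : ∀ i, (T i).Nonempty → dimH (T i) < K)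
    {ε : ℝ} (hε : 0 < ε) : SmallCover C ε K := by
  rcases C.eq_empty_or_nonempty with rfl | ⟨z, hz⟩
  · exact smallCover_empty ε K
  obtain ⟨i, hi⟩ := mem_iUnion.1 (hCT hz)
  have hI : Nonempty I := ⟨i⟩
  -- Empty pieces have dimension zero, so they need `K` positive; a nonempty piece supplies this.
  -- For `K = 0` all pieces must be empty.
  have hK : (0 : ENNReal) < K := bot_le.trans_lt (hT i ⟨z, hi⟩)
  refine smallCover_of_dimH_lt hC ((dimH_mono hCT).trans_lt ?_) hε
  have := Finite.to_countable (α := I)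
  rw [dimH_iUnion]
  obtain ⟨j, hj⟩ := exists_eq_ciSup_of_finite (f := fun i => dimH (T i))
  rw [← hj]
  rcases (T j).eq_empty_or_nonempty with h | h
  · simpa [h] using hK
  · exact hT j h

/-- Disjoint subsets of cardinality at most `n + 1` extend to disjoint subsets indexed by
`Fin (n + 1)` after adding enough elements. -/
theorem exists_embedding_of_disjoint {s q n : ℕ} (S : Fin q → Set (Fin s))
    (hdisj : ∀ a b, a ≠ b → Disjoint (S a) (S b)) (hcard : ∀ a, (S a).encard ≤ n + 1) :
    ∃ e : Fin q × Fin (n + 1) ↪ Fin s ⊕ Fin q × Fin (n + 1),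
      ∀ a, ∀ i ∈ S a, ∃ j, e (a, j) = Sum.inl i := by
  classical
  have hfin : ∀ a, ∃ g : S a → Fin (n + 1), Function.Injective g := by
    intro a
    have h1 : (S a).encard ≤ ((n + 1 : ℕ) : ℕ∞) := by exact_mod_cast hcard a
    rw [(toFinite (S a)).encard_eq_coe_toFinset_card] at h1
    have h2 : Fintype.card (S a) ≤ Fintype.card (Fin (n + 1)) := by
      rw [Fintype.card_fin, ← toFinset_card]
      have : (toFinite (S a)).toFinset = (S a).toFinset := by ext; simp
      rw [← this]
      exact_mod_cast h1
    obtain ⟨g⟩ := Function.Embedding.nonempty_of_card_le h2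
    exact ⟨g, g.injective⟩
  choose g hg using hfin
  -- Vacant slots are filled by dummy vertices from the right summand, one reserved for each slot,
  -- so that every tuple has full size.
  let e : Fin q × Fin (n + 1) → Fin s ⊕ Fin q × Fin (n + 1) := fun p =>
    if h : ∃ i : S p.1, g p.1 i = p.2 then Sum.inl h.choose.1 else Sum.inr p
  have he : ∀ a (i : S a), e (a, g a i) = Sum.inl i.1 := by
    intro a i
    have h : ∃ i' : S a, g a i' = g a i := ⟨i, rfl⟩
    change (if h : ∃ i' : S a, g a i' = g a i then _ else _) = _
    rw [dif_pos h, hg a h.choose_spec]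
  refine ⟨⟨e, ?_⟩, fun a i hi => ⟨g a ⟨i, hi⟩, he a ⟨i, hi⟩⟩⟩
  have he' : ∀ a j, (∃ i : S a, g a i = j ∧ e (a, j) = Sum.inl i.1) ∨
      e (a, j) = Sum.inr (a, j) := by
    intro a j
    by_cases h : ∃ i : S a, g a i = j
    · obtain ⟨i, rfl⟩ := h
      exact Or.inl ⟨i, rfl, he a i⟩
    · exact Or.inr (dif_neg h)
  rintro ⟨a, j⟩ ⟨b, k⟩ hab
  rcases he' a j with ⟨i, hi, hai⟩ | hai <;> rcases he' b k with ⟨i', hi', hbi⟩ | hbi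
  · rw [hai, hbi] at hab
    have hii : i.1 = i'.1 := Sum.inl_injective hab
    have h1 : a = b := by
      by_contra hne
      exact Set.disjoint_left.1 (hdisj a b hne) i.2 (hii ▸ i'.2)
    subst h1
    rw [← hi, ← hi', Subtype.ext hii]
  · rw [hai, hbi] at hab
    cases hab
  · rw [hai, hbi] at hab
    cases hab
  · rw [hai, hbi] at hab
    exact Sum.inr_injective hab

/-- If finite families of points of `ℝ^m` can be perturbed so that the sets of `d`-planes meeting
the spans of `q` disjoint `(n + 1)`-tuples have small Hausdorff dimension, then the maps whose
separated secant planes have fine covers of small order are dense. -/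
theorem exists_approximation_smallCover_secants {q d m n K : ℕ} (hq : 0 < q)
    (hgen : ∀ (ι : Type) [Finite ι] (v₀ : ι → Euc m) (η : ℝ), 0 < η →
      ∃ v : ι → Euc m, (∀ i, dist (v₀ i) (v i) < η) ∧ ∀ e : Fin q × Fin (n + 1) ↪ ι,
        (planesThrough d fun a j => v (e (a, j))).Nonempty →
          dimH (planesThrough d fun a j => v (e (a, j))) < K)
    {X : Type*} [MetricSpace X] {A : Set X} (hA : IsCompact A) (hn : CoverOrderLE A (n + 1))
    (g : C(X, Euc m)) {δ ε η : ℝ} (hδ : 0 < δ) (hε : 0 < ε) (hη : 0 < η) :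
    ∃ h : C(X, Euc m), (∀ x ∈ A, dist (g x) (h x) < η) ∧ SmallCover (secants q d h A δ) ε K := by
  obtain ⟨s, v₀, w, hw1, hwn, hwδ, happ⟩ := exists_polyhedral_approximation hA hn g hδ hη
  obtain ⟨v, hv, hvT⟩ := hgen (Fin s ⊕ Fin q × Fin (n + 1)) (Sum.elim v₀ fun _ => 0) (η / 2)
    (half_pos hη)
  obtain ⟨h, hgh, hh⟩ := happ (fun i => v (Sum.inl i)) fun i => hv (Sum.inl i)
  refine ⟨h, hgh, smallCover_of_subset_iUnion (isCompact_secants hq h.continuous hA δ).isBounded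
    _ ?_ hvT hε⟩
  rintro z ⟨x, hxA, hxδ, hxi⟩
  -- Points sharing a vertex are less than `δ` apart, so the `δ`-separated points have disjoint
  -- supports.
  obtain ⟨e, he⟩ := exists_embedding_of_disjoint (fun a => {i | w ⟨x a, hxA a⟩ i ≠ 0})
    (fun a b hab => Set.disjoint_left.2 fun i hi hi' =>
      absurd (hxδ a b hab) (not_le.2 (hwδ _ _ i hi hi'))) (fun a => hwn _)
  refine mem_iUnion.2 ⟨e, fun a => ?_⟩
  let W : Fin s ⊕ Fin q × Fin (n + 1) → ℝ := Sum.elim (w ⟨x a, hxA a⟩) fun _ => 0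
  have hW : ∀ i ∉ range fun j => e (a, j), W i = 0 := by
    rintro (i | i) hi
    · by_contra hne
      obtain ⟨j, hj⟩ := he a i hne
      exact hi ⟨j, hj⟩
    · rfl
  have hinj : Function.Injective fun j => e (a, j) := fun j k hjk =>
    (Prod.ext_iff.1 (e.injective hjk)).2
  refine ⟨fun j => W (e (a, j)), ?_, ?_⟩
  · rw [← hw1 ⟨x a, hxA a⟩, Fintype.sum_of_injective _ hinj _ W hW fun j => rfl]
    simp [W]
  · have h1 : ∑ j, W (e (a, j)) • v (e (a, j)) = h (x a) := by
      rw [hh ⟨x a, hxA a⟩, Fintype.sum_of_injective _ hinj _ (fun i => W i • v i)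
        (fun i hi => by rw [hW i hi, zero_smul]) fun j => rfl]
      simp [W]
    rw [h1]
    exact hxi a

/-! ### General position -/

/-- By the identity theorem, the nonvanishing set of a nonzero analytic function on a connected
space is open and dense; Baire intersects these sets. -/
theorem exists_near_forall_ne_zero {V I : Type*} [NormedAddCommGroup V] [NormedSpace ℝ V]
    [CompleteSpace V] [Finite I] (F : I → V → ℝ) (hF : ∀ i, AnalyticOnNhd ℝ (F i) univ)
    (hne : ∀ i, ∃ x, F i x ≠ 0) (v₀ : V) {η : ℝ} (hη : 0 < η) :
    ∃ v, dist v₀ v < η ∧ ∀ i, F i v ≠ 0 := by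
  have := Finite.to_countable (α := I)
  have hd : Dense (⋂ i, {v | F i v ≠ 0}) := by
    refine dense_iInter_of_isOpen (fun i => ?_) fun i => ?_
    · exact isOpen_ne_fun (continuousOn_univ.1 (hF i).continuousOn) continuous_const
    · by_contra hnd
      obtain ⟨x, hx⟩ := not_forall.1 hnd
      rw [mem_closure_iff_frequently, Filter.not_frequently] at hx
      obtain ⟨y, hy⟩ := hne i
      refine hy ((hF i).eqOn_zero_of_preconnected_of_eventuallyEq_zero isPreconnected_univ
        (mem_univ x) ?_ (mem_univ y))
      filter_upwards [hx] with z hz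
      simpa using hz
  obtain ⟨v, hv, hvd⟩ := hd.exists_dist_lt v₀ hη
  exact ⟨v, hvd, fun i => mem_iInter.1 hv i⟩

/-- Every at most `m + 1` points of the family `v` in `ℝ^m` are affinely independent. -/
def InGeneralPosition {ι : Type*} {m : ℕ} (v : ι → Euc m) : Prop :=
  ∀ S : Finset ι, S.card ≤ m + 1 → ∀ c : ι → ℝ, ∑ i ∈ S, c i = 0 → ∑ i ∈ S, c i • v i = 0 →
    ∀ i ∈ S, c i = 0

/-- The Gram determinant of the points `v i`, `i ∈ S`, placed at height one. -/
noncomputable def liftedGram {ι : Type*} [DecidableEq ι] {m : ℕ} (S : Finset ι) (v : ι → Euc m) :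
    ℝ :=
  (Matrix.of fun i j : S => 1 + inner ℝ (v i) (v j)).det

theorem analyticOnNhd_liftedGram {ι : Type*} [Fintype ι] [DecidableEq ι] {m : ℕ} (S : Finset ι) :
    AnalyticOnNhd ℝ (liftedGram S : (ι → Euc m) → ℝ) univ := by
  rw [← contDiff_omega_iff_analyticOnNhd]
  unfold liftedGram
  simp only [Matrix.det_apply]
  refine ContDiff.sum fun σ _ => ContDiff.const_smul _ (contDiff_prod fun i _ => ?_)
  exact contDiff_const.add ((contDiff_apply ℝ (Euc m) _).inner ℝ (contDiff_apply ℝ (Euc m) _))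

theorem liftedGram_quadratic {ι : Type*} {m : ℕ} (S : Finset ι) (v : ι → Euc m) (c : S → ℝ) :
    ∑ i : S, c i * ∑ j : S, (1 + inner ℝ (v i) (v j)) * c j =
      (∑ i, c i) ^ 2 + ‖∑ i, c i • v i‖ ^ 2 := by
  rw [← real_inner_self_eq_norm_sq, sum_inner]
  simp_rw [inner_sum, inner_smul_left, inner_smul_right]
  rw [sq, Finset.sum_mul_sum, ← Finset.sum_add_distrib]
  refine Finset.sum_congr rfl fun i _ => ?_
  rw [← Finset.sum_add_distrib, Finset.mul_sum]
  refine Finset.sum_congr rfl fun j _ => ?_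
  simp
  ring

/-- An affine relation is a linear relation among the lifted vectors `(1, v i)`, hence lies in the
kernel of their Gram matrix. -/
theorem affineIndependent_of_liftedGram_ne_zero {ι : Type*} [DecidableEq ι] {m : ℕ}
    {S : Finset ι} {v : ι → Euc m} (h : liftedGram S v ≠ 0) {c : ι → ℝ}
    (h0 : ∑ i ∈ S, c i = 0) (h1 : ∑ i ∈ S, c i • v i = 0) : ∀ i ∈ S, c i = 0 := by
  by_contra! hne
  obtain ⟨i, hi, hci⟩ := hne
  refine h (Matrix.exists_mulVec_eq_zero_iff.1 ⟨fun j : S => c j, fun hc => hci ?_, ?_⟩)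
  · exact congrFun hc ⟨i, hi⟩
  · ext k
    rw [← Finset.sum_coe_sort] at h0 h1
    simp only [Matrix.mulVec, dotProduct, Matrix.of_apply, Pi.zero_apply, add_mul, one_mul]
    rw [Finset.sum_add_distrib, h0, zero_add]
    have := congrArg (inner ℝ (v k)) h1
    rw [inner_sum, inner_zero_right] at this
    rw [← this]
    refine Finset.sum_congr rfl fun j _ => ?_
    rw [inner_smul_right, mul_comm]

/-- The origin and the standard basis vectors give `m + 1` affinely independent points. -/
theorem exists_liftedGram_ne_zero {ι : Type*} [DecidableEq ι] {m : ℕ} (S : Finset ι)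
    (hS : S.card ≤ m + 1) : ∃ v : ι → Euc m, liftedGram S v ≠ 0 := by
  have hcard : Fintype.card S ≤ Fintype.card (Option (Fin m)) := by simpa using hS
  obtain ⟨e⟩ := Function.Embedding.nonempty_of_card_le hcard
  let b : Option (Fin m) → Euc m := fun o => o.elim 0 fun k => EuclideanSpace.single k 1
  let v : ι → Euc m := fun i => if h : i ∈ S then b (e ⟨i, h⟩) else 0
  have hv : ∀ i : S, v i = b (e i) := fun i => by simp [v, i.2]
  refine ⟨v, fun hdet => ?_⟩
  obtain ⟨c, hc, hMc⟩ := Matrix.exists_mulVec_eq_zero_iff.2 hdet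
  have hq := liftedGram_quadratic S v c
  have hz : ∑ i : S, c i * ∑ j : S, (1 + inner ℝ (v i) (v j)) * c j = 0 :=
    Finset.sum_eq_zero fun i _ => by
      have := congrFun hMc i
      simp only [Matrix.mulVec, dotProduct, Matrix.of_apply, Pi.zero_apply] at this
      rw [this, mul_zero]
  rw [hz] at hq
  have h0 : ∑ i, c i = 0 := by nlinarith [sq_nonneg (∑ i, c i), sq_nonneg ‖∑ i, c i • v i‖]
  have h1 : ∑ i, c i • v i = 0 := by
    rw [← norm_eq_zero]
    nlinarith [sq_nonneg (∑ i, c i), sq_nonneg ‖∑ i, c i • v i‖]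
  have hk : ∀ i : S, (e i).isSome → c i = 0 := by
    intro i hi
    obtain ⟨k, hk⟩ := Option.isSome_iff_exists.1 hi
    have h2 := congrArg (fun x : Euc m => x k) h1
    simp only [hv, WithLp.ofLp_sum, WithLp.ofLp_smul, Finset.sum_apply, Pi.smul_apply,
      smul_eq_mul, PiLp.zero_apply] at h2
    rw [Finset.sum_eq_single i] at h2
    · simpa [hk, b] using h2
    · intro j _ hji
      have hne : e j ≠ some k := fun h => hji (e.injective (h.trans hk.symm))
      rcases hej : e j with _ | k'
      · simp [b]
      · have : k ≠ k' := fun h => hne (by rw [hej, h])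
        simp [b, this]
    · simp
  refine hc (funext fun i => ?_)
  rcases hei : e i with _ | k
  · rw [Finset.sum_eq_single i] at h0
    · exact h0
    · intro j _ hji
      refine hk j (Option.isSome_iff_ne_none.2 fun h => hji (e.injective (h.trans hei.symm)))
    · simp
  · exact hk i (by rw [hei]; rfl)

/-- Finite families of points of `ℝ^m` can be perturbed to general position, and such that finitely
many further nonzero analytic functions do not vanish. -/
theorem exists_near_inGeneralPosition {ι I : Type*} [Finite ι] [Finite I] {m : ℕ}
    (F : I → (ι → Euc m) → ℝ)
    (hF : ∀ [Fintype ι], ∀ i, AnalyticOnNhd ℝ (F i) univ) (hne : ∀ i, ∃ x, F i x ≠ 0)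
    (v₀ : ι → Euc m) {η : ℝ} (hη : 0 < η) :
    ∃ v : ι → Euc m, (∀ i, dist (v₀ i) (v i) < η) ∧ InGeneralPosition v ∧ ∀ i, F i v ≠ 0 := by
  classical
  have := Fintype.ofFinite ι
  obtain ⟨v, hv, hvF⟩ := exists_near_forall_ne_zero
    (I := {S : Finset ι // S.card ≤ m + 1} ⊕ I)
    (Sum.elim (fun S => liftedGram S.1) F)
    (by
      rintro (S | i)
      exacts [analyticOnNhd_liftedGram S.1, hF i])
    (by
      rintro (S | i)
      exacts [exists_liftedGram_ne_zero S.1 S.2, hne i]) v₀ hη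
  refine ⟨v, fun i => (dist_le_pi_dist v₀ v i).trans_lt hv, fun S hS c h0 h1 =>
    affineIndependent_of_liftedGram_ne_zero (hvF (Sum.inl ⟨S, hS⟩)) h0 h1,
    fun i => hvF (Sum.inr i)⟩

theorem InGeneralPosition.comp {ι κ : Type*} {m : ℕ} {v : ι → Euc m} (hv : InGeneralPosition v)
    (e : κ ↪ ι) : InGeneralPosition (v ∘ e) := by
  classical
  intro S hS c h0 h1 i hi
  have hinv : ∀ k, Function.extend e c 0 (e k) = c k := fun k => e.injective.extend_apply c 0 k
  have := hv (S.map e) (by simpa using hS) (Function.extend e c 0) (by simpa [hinv] using h0)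
    (by simpa [hinv] using h1) (e i) (Finset.mem_map_of_mem e hi)
  rwa [hinv] at this

/-! ### Hausdorff dimension of images and of Grassmannians -/

theorem dimH_image_le_of_contDiffAt {V F : Type*} [NormedAddCommGroup V] [NormedSpace ℝ V]
    [FiniteDimensional ℝ V] [NormedAddCommGroup F] [NormedSpace ℝ F] {f : V → F} {s : Set V}
    (hf : ∀ x ∈ s, ContDiffAt ℝ 1 f x) : dimH (f '' s) ≤ dimH s := by
  have : ProperSpace V := FiniteDimensional.proper_real V
  refine dimH_image_le_of_locally_lipschitzOn fun x hx => ?_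
  obtain ⟨K, t, ht, hK⟩ := (hf x hx).exists_lipschitzOnWith
  exact ⟨K, t, mem_nhdsWithin_of_mem_nhds ht, hK⟩

theorem dimH_image_le_finrank {V F : Type*} [NormedAddCommGroup V] [NormedSpace ℝ V]
    [FiniteDimensional ℝ V] [NormedAddCommGroup F] [NormedSpace ℝ F] {f : V → F} {s : Set V}
    (hf : ∀ x ∈ s, ContDiffAt ℝ 1 f x) : dimH (f '' s) ≤ Module.finrank ℝ V :=
  (dimH_image_le_of_contDiffAt hf).trans
    ((dimH_mono (subset_univ s)).trans_eq (Real.dimH_univ_eq_finrank V))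

/-- Near `e`, a projection is controlled by its off-diagonal block. For `D = p - q`, the identity `D
= p * D + D * q` bounds each diagonal block of `D` by `‖D‖ / 4`, and the two off-diagonal blocks are
adjoint; so `‖D‖` is at most `‖D‖ / 2` plus twice the norm of one such block. -/
theorem norm_sub_le_of_isStarProjection {A : Type*} [NormedRing A] [StarRing A]
    [NormedStarGroup A] {p q e : A} (hp : IsStarProjection p) (hq : IsStarProjection q)
    (he : IsStarProjection e) (he1 : ‖e‖ ≤ 1) (he1' : ‖1 - e‖ ≤ 1) (hpe : ‖p - e‖ ≤ 1 / 8)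
    (hqe : ‖q - e‖ ≤ 1 / 8) : ‖p - q‖ ≤ 4 * ‖(1 - e) * (p - q) * e‖ := by
  have hpp : p * p = p := hp.isIdempotentElem
  have hqq : q * q = q := hq.isIdempotentElem
  have hee : e * e = e := he.isIdempotentElem
  have hD : p - q = p * (p - q) + (p - q) * q := by
    rw [mul_sub, sub_mul, hpp, hqq]
    abel
  set D := p - q with hDdef
  have hDs : star D = D := by
    rw [hDdef, star_sub, hp.isSelfAdjoint.star_eq, hq.isSelfAdjoint.star_eq]
  set f := 1 - e with hf
  have hfs : star f = f := by rw [hf, star_sub, star_one, he.isSelfAdjoint.star_eq]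
  have hfe : f * e = 0 := by rw [hf, sub_mul, one_mul, hee, sub_self]
  have hef : e * f = 0 := by rw [hf, mul_sub, mul_one, hee, sub_self]
  have hsplit : D = (e * D * e + f * D * f) + (e * D * f + f * D * e) := by
    rw [hf]
    noncomm_ring
  have h1 : e * D * e = -(e * (p - e) * D * e + e * D * (q - e) * e) := by
    have h2 : e * D * e = e * (p * D + D * q) * e := congrArg (fun x => e * x * e) hD
    have h3 : e * (p * D + D * q) * e =
        e * (p - e) * D * e + e * D * (q - e) * e + (e * e) * D * e + e * D * (e * e) := by
      noncomm_ring
    rw [h3, hee] at h2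
    have h4 : e * (p - e) * D * e + e * D * (q - e) * e + e * D * e = 0 := by
      refine add_right_cancel (b := e * D * e) ?_
      rw [zero_add]
      exact h2.symm
    exact eq_neg_of_add_eq_zero_right h4
  have h2 : f * D * f = f * (p - e) * D * f + f * D * (q - e) * f := by
    have h2 : f * D * f = f * (p * D + D * q) * f := congrArg (fun x => f * x * f) hD
    have h3 : f * (p * D + D * q) * f =
        f * (p - e) * D * f + f * D * (q - e) * f + (f * e) * D * f + f * D * (e * f) := by
      noncomm_ring
    rw [h3, hfe, hef] at h2
    simpa using h2
  have hbound : ∀ x y : A, ‖x‖ ≤ 1 → ‖y‖ ≤ 1 → ‖x * (p - e) * D * y‖ ≤ ‖D‖ / 8 ∧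
      ‖x * D * (q - e) * y‖ ≤ ‖D‖ / 8 := by
    intro x y hx hy
    constructor
    · calc ‖x * (p - e) * D * y‖ ≤ ‖x‖ * ‖p - e‖ * ‖D‖ * ‖y‖ :=
          (norm_mul_le _ _).trans (by gcongr; exact norm_mul₃_le)
        _ ≤ 1 * (1 / 8) * ‖D‖ * 1 := by gcongr
        _ = ‖D‖ / 8 := by ring
    · calc ‖x * D * (q - e) * y‖ ≤ ‖x‖ * ‖D‖ * ‖q - e‖ * ‖y‖ :=
          (norm_mul_le _ _).trans (by gcongr; exact norm_mul₃_le)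
        _ ≤ 1 * ‖D‖ * (1 / 8) * 1 := by gcongr
        _ = ‖D‖ / 8 := by ring
  have h3 : ‖e * D * f‖ = ‖f * D * e‖ := by
    rw [← norm_star, star_mul, star_mul, hfs, hDs, he.isSelfAdjoint.star_eq, mul_assoc]
  have h4 : ‖e * D * e‖ ≤ ‖D‖ / 4 := by
    rw [h1, norm_neg]
    have := hbound e e he1 he1
    linarith [norm_add_le (e * (p - e) * D * e) (e * D * (q - e) * e)]
  have h5 : ‖f * D * f‖ ≤ ‖D‖ / 4 := by
    rw [h2]
    have := hbound f f he1' he1'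
    linarith [norm_add_le (f * (p - e) * D * f) (f * D * (q - e) * f)]
  have h6 := norm_add_le (e * D * e + f * D * f) (e * D * f + f * D * e)
  rw [← hsplit] at h6
  linarith [norm_add_le (e * D * e) (f * D * f), norm_add_le (e * D * f) (f * D * e)]

/-- The Grassmannian of `d`-dimensional linear subspaces of `ℝ^m` as a set of orthogonal
projections. -/
def grassmannian (m d : ℕ) : Set (Euc m →L[ℝ] Euc m) :=
  {A | IsStarProjection A ∧ LinearMap.trace ℝ (Euc m) A = d}

/-- The product of `ℝ^n` and the Grassmannian of `d`-planes in `ℝ^m` has Hausdorff dimension at most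
`n + d (m - d)`. -/
theorem dimH_univ_prod_grassmannian_le (n m d : ℕ) :
    dimH ((univ : Set (Fin n → ℝ)) ×ˢ grassmannian m d) ≤ (n + d * (m - d) : ℕ) := by
  by_contra! hlt
  -- Hausdorff dimension is local, so a chart near one projection `P` suffices.
  obtain ⟨⟨a, P⟩, ⟨-, hP, htr⟩, hloc⟩ := exists_mem_nhdsWithin_lt_dimH_of_lt_dimH hlt
  dsimp only at hP htr
  obtain ⟨U, hPU⟩ : ∃ U : Submodule ℝ (Euc m), P = U.starProjection := by
    obtain ⟨_, hPU⟩ := isStarProjection_iff_eq_starProjection_range.1 hP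
    exact ⟨_, hPU⟩
  have hUd : Module.finrank ℝ U = d := by
    have := trace_starProjection U
    rw [← hPU, htr] at this
    exact_mod_cast this.symm
  have hUo : Module.finrank ℝ Uᗮ = m - d := by
    have := U.finrank_add_finrank_orthogonal
    rw [finrank_euclideanSpace_fin] at this
    omega
  let S : Set ((Fin n → ℝ) × (Euc m →L[ℝ] Euc m)) :=
    univ ×ˢ (grassmannian m d ∩ Metric.ball P (1 / 8))
  have hS := hloc S (by
    refine Filter.mem_of_superset (inter_mem_nhdsWithin _
      ((Metric.isOpen_ball.preimage continuous_snd).mem_nhds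
        (Metric.mem_ball_self (x := P) (ε := 1 / 8) (by norm_num)))) ?_
    rintro ⟨w, A⟩ ⟨⟨-, hA⟩, hA'⟩
    exact ⟨trivial, hA, hA'⟩)
  let ψ : (U →ₗ[ℝ] Uᗮ) →ₗ[ℝ] (Euc m →L[ℝ] Euc m) :=
    { toFun := fun B => LinearMap.toContinuousLinearMap
        (Uᗮ.subtype ∘ₗ B ∘ₗ (U.orthogonalProjectionOnto : Euc m →ₗ[ℝ] U))
      map_add' := fun B B' => by ext x; simp
      map_smul' := fun c B => by ext x; simp }
  let R : Submodule ℝ ((Fin n → ℝ) × (Euc m →L[ℝ] Euc m)) :=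
    (LinearMap.prodMap (LinearMap.id : (Fin n → ℝ) →ₗ[ℝ] (Fin n → ℝ)) ψ).range
  have hP' : (1 : Euc m →L[ℝ] Euc m) - P = Uᗮ.starProjection := by
    rw [hPU, Submodule.starProjection_orthogonal']
  -- The chart takes the block from `U` to `Uᗮ`; it is antilipschitz, with values in a linear space
  -- of dimension at most `n + d * (m - d)`.
  let G : S → (Fin n → ℝ) × (Euc m →L[ℝ] Euc m) := fun s => (s.1.1, (1 - P) * s.1.2 * P)
  have hG : AntilipschitzWith 4 G := by
    refine AntilipschitzWith.of_le_mul_dist fun s t => ?_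
    obtain ⟨⟨w, A⟩, -, hA, hAP⟩ := s
    obtain ⟨⟨w', B⟩, -, hB, hBP⟩ := t
    have h1 : ‖A - B‖ ≤ 4 * ‖(1 - P) * (A - B) * P‖ := by
      refine norm_sub_le_of_isStarProjection hA.1 hB.1 hP ?_ ?_ ?_ ?_
      · rw [hPU]
        exact Submodule.starProjection_norm_le _
      · rw [hP']
        exact Submodule.starProjection_norm_le _
      · exact (mem_ball_iff_norm.1 hAP).le
      · exact (mem_ball_iff_norm.1 hBP).le
    change max (dist w w') (dist A B) ≤
      4 * max (dist w w') (dist ((1 - P) * A * P) ((1 - P) * B * P))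
    have h2 := le_max_left (dist w w') (dist ((1 - P) * A * P) ((1 - P) * B * P))
    have h3 := le_max_right (dist w w') (dist ((1 - P) * A * P) ((1 - P) * B * P))
    have h4 : 0 ≤ dist w w' := dist_nonneg
    refine max_le (by linarith) ?_
    have h5 : dist ((1 - P) * A * P) ((1 - P) * B * P) = ‖(1 - P) * (A - B) * P‖ := by
      rw [dist_eq_norm, ← sub_mul, ← mul_sub]
    rw [dist_eq_norm A B]
    linarith
  have hGR : G '' univ ⊆ R := by
    rintro _ ⟨⟨⟨w, A⟩, -⟩, -, rfl⟩
    refine ⟨(w, (Uᗮ.orthogonalProjectionOnto : Euc m →ₗ[ℝ] Uᗮ) ∘ₗ (A : Euc m →ₗ[ℝ] Euc m) ∘ₗ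
      U.subtype), Prod.ext rfl ?_⟩
    change _ = (1 - P) * A * P
    rw [hP', hPU]
    rfl
  have hR : Module.finrank ℝ R ≤ n + d * (m - d) := by
    refine (LinearMap.finrank_range_le _).trans_eq ?_
    rw [Module.finrank_prod, Module.finrank_linearMap, hUd, hUo, Module.finrank_fin_fun]
  have h1 : dimH S ≤ dimH (G '' univ) := by
    have h2 := (isometry_subtype_coe (s := S)).dimH_image univ
    rw [image_univ, Subtype.range_coe] at h2
    rw [h2]
    exact hG.le_dimH_image univ
  have h2 : dimH (R : Set ((Fin n → ℝ) × (Euc m →L[ℝ] Euc m))) = Module.finrank ℝ R := by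
    rw [← Subtype.range_coe (s := (R : Set ((Fin n → ℝ) × (Euc m →L[ℝ] Euc m)))), ← image_univ]
    exact (R.subtypeₗᵢ.isometry.dimH_image univ).trans (Real.dimH_univ_eq_finrank R)
  refine absurd hS (not_lt.2 ((h1.trans (dimH_mono hGR)).trans ?_))
  rw [h2]
  exact_mod_cast hR

/-! ### Planes through an affine subspace -/

/-- The affine parametrization of the affine span of the points `u j`. -/
noncomputable def affPoint {n m : ℕ} (u : Fin (n + 1) → Euc m) (a : Fin n → ℝ) : Euc m :=
  (1 - ∑ j, a j) • u 0 + ∑ j, a j • u j.succ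

theorem contDiff_affPoint {n m : ℕ} (u : Fin (n + 1) → Euc m) : ContDiff ℝ 1 (affPoint u) := by
  unfold affPoint
  fun_prop

theorem affPoint_eq {n m : ℕ} (u : Fin (n + 1) → Euc m) {w : Fin (n + 1) → ℝ}
    (hw : ∑ j, w j = 1) : affPoint u (fun j => w j.succ) = ∑ j, w j • u j := by
  rw [Fin.sum_univ_succ] at hw ⊢
  rw [affPoint, ← hw, add_sub_cancel_right]

/-- A plane is determined by its direction projection `A` and one point `x`, the foot being `x - A
x`. No general position is needed. -/
theorem dimH_planesThrough_one_lt {n m d : ℕ} (u : Fin 1 → Fin (n + 1) → Euc m) :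
    dimH (planesThrough d u) < (n + d * (m - d) + 1 : ℕ) := by
  let Φ : (Fin n → ℝ) × (Euc m →L[ℝ] Euc m) → PlaneSpace m :=
    fun p => (affPoint (u 0) p.1 - p.2 (affPoint (u 0) p.1), p.2)
  have hΦ : ContDiff ℝ 1 Φ := by
    have h1 : ContDiff ℝ 1 fun p : (Fin n → ℝ) × (Euc m →L[ℝ] Euc m) => affPoint (u 0) p.1 :=
      (contDiff_affPoint (u 0)).comp contDiff_fst
    exact (h1.sub (contDiff_snd.clm_apply h1)).prodMk contDiff_snd
  have hsub : planesThrough d u ⊆ Φ '' (univ ×ˢ grassmannian m d) := by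
    rintro ⟨a, A⟩ hz
    obtain ⟨w, hw, hA, htr, hx⟩ := hz 0
    refine ⟨(fun j => w j.succ, A), ⟨trivial, hA, htr⟩, Prod.ext ?_ rfl⟩
    dsimp only [Φ] at hx ⊢
    rw [affPoint_eq _ hw, hx]
    simp
  refine ((dimH_mono hsub).trans ((dimH_image_le_of_contDiffAt fun x _ => hΦ.contDiffAt).trans
    (dimH_univ_prod_grassmannian_le n m d))).trans_lt ?_
  exact_mod_cast Nat.lt_succ_self _

/-! ### Lines -/

/-- The line through `x` with direction `r`, as a point of `PlaneSpace m`. -/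
noncomputable def lineThrough {m : ℕ} (x r : Euc m) : PlaneSpace m :=
  (x - (inner ℝ r x / ‖r‖ ^ 2) • r,
    (‖r‖ ^ 2)⁻¹ • (innerSL ℝ r).smulRight r)

theorem contDiffAt_lineThrough {m : ℕ} {V : Type*} [NormedAddCommGroup V] [NormedSpace ℝ V]
    {p r : V → Euc m} {x : V} (hp : ContDiffAt ℝ 1 p x) (hr : ContDiffAt ℝ 1 r x)
    (h0 : r x ≠ 0) : ContDiffAt ℝ 1 (fun y => lineThrough (p y) (r y)) x := by
  have hn : ContDiffAt ℝ 1 (fun y => ‖r y‖ ^ 2) x := hr.norm_sq ℝ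
  have hn0 : ‖r x‖ ^ 2 ≠ 0 := by simpa using h0
  refine ContDiffAt.prodMk ?_ ?_
  · exact hp.sub (((hr.inner ℝ hp).div hn hn0).smul hr)
  · have h1 : ContDiffAt ℝ 1 (fun y => innerSL ℝ (r y)) x :=
      (innerSL ℝ (E := Euc m)).contDiff.contDiffAt.comp x hr
    exact (hn.inv hn0).smul (h1.smulRight hr)

theorem sub_mem_direction_of_mem_incidence {m d : ℕ} {x y : Euc m} {z : PlaneSpace m}
    (hx : (x, z) ∈ incidence m d) (hy : (y, z) ∈ incidence m d) : z.2 (y - x) = y - x := by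
  rw [map_sub, hx.2.2, hy.2.2]
  abel

theorem apply_eq_of_mem_incidence_one {m : ℕ} {x r : Euc m} {z : PlaneSpace m}
    (hx : (x, z) ∈ incidence m 1) (hr : z.2 r = r) (h0 : r ≠ 0) (y : Euc m) :
    z.2 y = (inner ℝ r y / ‖r‖ ^ 2) • r := by
  obtain ⟨hA, htr, -⟩ := hx
  obtain ⟨U, hU⟩ : ∃ U : Submodule ℝ (Euc m), z.2 = U.starProjection := by
    obtain ⟨_, h⟩ := isStarProjection_iff_eq_starProjection_range.1 hA
    exact ⟨_, h⟩
  have hd : Module.finrank ℝ U = 1 := by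
    have := trace_starProjection U
    rw [← hU, htr] at this
    exact_mod_cast this.symm
  have hrU : r ∈ U := by
    rw [hU] at hr
    exact Submodule.starProjection_eq_self_iff.1 hr
  have hspan : Submodule.span ℝ {r} = U := by
    refine Submodule.eq_of_le_of_finrank_le ((Submodule.span_singleton_le_iff_mem _ _).2 hrU) ?_
    rw [hd, finrank_span_singleton h0]
  rw [hU, ← starProjection_congr hspan, Submodule.starProjection_singleton]
  simp

theorem eq_lineThrough {m : ℕ} {x r : Euc m} {z : PlaneSpace m} (hx : (x, z) ∈ incidence m 1)
    (hr : z.2 r = r) (h0 : r ≠ 0) : z = lineThrough x r := by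
  have h := apply_eq_of_mem_incidence_one hx hr h0
  refine Prod.ext ?_ (ContinuousLinearMap.ext fun y => ?_)
  · have h1 : z.2 x = x - z.1 := hx.2.2
    have h2 : z.1 = x - z.2 x := by rw [h1]; simp
    rw [h2, h]
    rfl
  · rw [h]
    simp [lineThrough, smul_smul, div_eq_inv_mul]

theorem exists_smul_eq_of_mem_incidence_one {m : ℕ} {x y y' : Euc m} {z : PlaneSpace m}
    (hx : (x, z) ∈ incidence m 1) (hy : (y, z) ∈ incidence m 1) (hy' : (y', z) ∈ incidence m 1)
    (hxy : x ≠ y) : ∃ t : ℝ, y' = (1 - t) • x + t • y := by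
  have h1 := apply_eq_of_mem_incidence_one hx (sub_mem_direction_of_mem_incidence hx hy)
    (sub_ne_zero.2 hxy.symm) (y' - x)
  rw [sub_mem_direction_of_mem_incidence hx hy'] at h1
  obtain ⟨t, ht⟩ : ∃ t : ℝ, y' - x = t • (y - x) := ⟨_, h1⟩
  refine ⟨t, ?_⟩
  rw [← sub_add_cancel y' x, ht]
  module

/-! ### Lines through two or three spans in general position -/

/-- Two blocks contain `2 * n + 2 ≤ m + 1` points, hence are jointly affinely independent; in
particular their spans are disjoint. -/
theorem InGeneralPosition.eq_zero_of_pair {q n m : ℕ} {u : Fin q × Fin (n + 1) → Euc m}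
    (hu : InGeneralPosition u) (hm : 2 * n + 1 ≤ m) {a b : Fin q} (hab : a ≠ b)
    {w w' : Fin (n + 1) → ℝ} (h0 : ∑ j, w j + ∑ j, w' j = 0)
    (h1 : ∑ j, w j • u (a, j) + ∑ j, w' j • u (b, j) = 0) : w = 0 ∧ w' = 0 := by
  classical
  have h := hu (({a, b} : Finset (Fin q)) ×ˢ Finset.univ) (by
      rw [Finset.card_product, Finset.card_pair hab, Finset.card_univ, Fintype.card_fin]
      omega) (fun p => if p.1 = a then w p.2 else w' p.2)
    (by
      rw [Finset.sum_product, Finset.sum_pair hab]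
      simpa [hab.symm] using h0)
    (by
      rw [Finset.sum_product, Finset.sum_pair hab]
      simpa [hab.symm] using h1)
  constructor
  · ext j
    simpa using h (a, j) (by simp)
  · ext j
    simpa [hab.symm] using h (b, j) (by simp)

theorem InGeneralPosition.sum_smul_ne {q n m : ℕ} {u : Fin q × Fin (n + 1) → Euc m}
    (hu : InGeneralPosition u) (hm : 2 * n + 1 ≤ m) {a b : Fin q} (hab : a ≠ b)
    {w w' : Fin (n + 1) → ℝ} (hw : ∑ j, w j = 1) (hw' : ∑ j, w' j = 1) :
    ∑ j, w j • u (a, j) ≠ ∑ j, w' j • u (b, j) := by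
  intro h
  have := hu.eq_zero_of_pair hm hab (w := w) (w' := -w') (by simp [hw, hw'])
    (by simp [h])
  rw [this.1] at hw
  simp at hw

/-- Each line is spanned by its points on the two disjoint spans, which gives `2 * n` smooth
parameters. -/
theorem dimH_planesThrough_two_lt {n m : ℕ} {u : Fin 2 × Fin (n + 1) → Euc m}
    (hu : InGeneralPosition u) (hm : 2 * n + 1 ≤ m) :
    dimH (planesThrough 1 fun a j => u (a, j)) < (2 * n + 1 : ℕ) := by
  let p : Fin 2 → (Fin n → ℝ) → Euc m := fun a => affPoint fun j => u (a, j)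
  let Φ : (Fin n → ℝ) × (Fin n → ℝ) → PlaneSpace m :=
    fun c => lineThrough (p 0 c.1) (p 1 c.2 - p 0 c.1)
  have hp : ∀ a, ContDiff ℝ 1 (p a) := fun a => contDiff_affPoint _
  have hsub : planesThrough 1 (fun a j => u (a, j)) ⊆ Φ '' {c | p 1 c.2 - p 0 c.1 ≠ 0} := by
    intro z hz
    choose w hw hz using hz
    have hne := hu.sum_smul_ne hm (show (0 : Fin 2) ≠ 1 by decide) (hw 0) (hw 1)
    have hpw : ∀ a, p a (fun j => w a j.succ) = ∑ j, w a j • u (a, j) :=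
      fun a => affPoint_eq _ (hw a)
    refine ⟨(fun j => w 0 j.succ, fun j => w 1 j.succ), ?_, ?_⟩
    · change p 1 _ - p 0 _ ≠ 0
      rw [hpw, hpw]
      exact sub_ne_zero.2 hne.symm
    · change lineThrough (p 0 _) (p 1 _ - p 0 _) = z
      rw [hpw, hpw]
      exact (eq_lineThrough (hz 0) (sub_mem_direction_of_mem_incidence (hz 0) (hz 1))
        (sub_ne_zero.2 hne.symm)).symm
  refine ((dimH_mono hsub).trans (dimH_image_le_finrank fun c hc => ?_)).trans_lt ?_
  · have h0 : ContDiffAt ℝ 1 (fun c : (Fin n → ℝ) × (Fin n → ℝ) => p 0 c.1) c :=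
      ((hp 0).comp contDiff_fst).contDiffAt
    have h1 : ContDiffAt ℝ 1 (fun c : (Fin n → ℝ) × (Fin n → ℝ) => p 1 c.2) c :=
      ((hp 1).comp contDiff_snd).contDiffAt
    exact contDiffAt_lineThrough h0 (h1.sub h0) hc
  · rw [Module.finrank_prod, Module.finrank_fin_fun]
    exact_mod_cast (by omega : n + n < 2 * n + 1)

/-- The linear map sending a family of coefficients to their sum and to the corresponding linear
combination of the points `u i`; its kernel consists of the affine relations between them. -/
noncomputable def affineRelationMap {ι : Type*} [Fintype ι] {m : ℕ} (u : ι → Euc m) :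
    (ι → ℝ) →ₗ[ℝ] ℝ × Euc m :=
  (Fintype.linearCombination ℝ fun i => ((1 : ℝ), u i))

theorem mem_ker_affineRelationMap {ι : Type*} [Fintype ι] {m : ℕ} {u : ι → Euc m} {c : ι → ℝ} :
    c ∈ (affineRelationMap u).ker ↔ ∑ i, c i = 0 ∧ ∑ i, c i • u i = 0 := by
  rw [LinearMap.mem_ker, affineRelationMap, Fintype.linearCombination_apply, Prod.ext_iff,
    Prod.fst_sum, Prod.snd_sum]
  simp

/-- No nonzero relation is supported on `m + 1` indices, so a relation is determined by its
remaining coefficients. -/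
theorem InGeneralPosition.finrank_ker_le {ι : Type*} [Fintype ι] {m : ℕ} {u : ι → Euc m}
    (hu : InGeneralPosition u) :
    Module.finrank ℝ (affineRelationMap u).ker ≤ Fintype.card ι - (m + 1) := by
  classical
  obtain ⟨S, hS, hSm⟩ : ∃ S : Finset ι, S.card ≤ m + 1 ∧ Sᶜ.card ≤ Fintype.card ι - (m + 1) := by
    rcases le_total (Fintype.card ι) (m + 1) with h | h
    · exact ⟨Finset.univ, by simpa using h, by simp⟩
    · obtain ⟨S, -, hS⟩ := Finset.exists_subset_card_eq (s := (Finset.univ : Finset ι)) h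
      exact ⟨S, hS.le, by rw [Finset.card_compl, hS]⟩
  let ρ : (affineRelationMap u).ker →ₗ[ℝ] ({i // i ∈ Sᶜ} → ℝ) :=
    LinearMap.funLeft ℝ ℝ (Subtype.val : {i // i ∈ Sᶜ} → ι) ∘ₗ (affineRelationMap u).ker.subtype
  have hρ : Function.Injective ρ := by
    rw [injective_iff_map_eq_zero]
    rintro ⟨c, hc⟩ hρc
    have hz : ∀ i ∉ S, c i = 0 := fun i hi =>
      congrFun hρc ⟨i, Finset.mem_compl.2 hi⟩
    rw [mem_ker_affineRelationMap] at hc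
    have h := hu S hS c
      (by rw [← hc.1]; exact Finset.sum_subset (Finset.subset_univ _) fun i _ hi => hz i hi)
      (by
        rw [← hc.2]
        exact Finset.sum_subset (Finset.subset_univ _) fun i _ hi => by rw [hz i hi, zero_smul])
    refine Subtype.ext (funext fun i => ?_)
    by_cases hi : i ∈ S
    exacts [h i hi, hz i hi]
  refine (LinearMap.finrank_le_finrank_of_injective hρ).trans ?_
  rw [Module.finrank_fintype_fun_eq_card, Fintype.card_coe]
  exact hSm

/-- Three collinear points on the three spans give an affine relation among all `3 * (n + 1)`
vertices, from which the line can be recovered smoothly. Fixing the third block sum at `-1` cuts the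
relation space down to a hyperplane missing the origin, one dimension lower. -/
theorem dimH_planesThrough_three_lt {n m : ℕ} {u : Fin 3 × Fin (n + 1) → Euc m}
    (hu : InGeneralPosition u) (hm : 2 * n + 1 ≤ m)
    (hne : (planesThrough 1 fun a j => u (a, j)).Nonempty) :
    dimH (planesThrough 1 fun a j => u (a, j)) < (3 * n + 2 - m : ℕ) := by
  let C := Fin 3 × Fin (n + 1) → ℝ
  let p₀ : C → Euc m := fun c => (∑ j, c (0, j))⁻¹ • ∑ j, c (0, j) • u (0, j)
  let p₂ : C → Euc m := fun c => -∑ j, c (2, j) • u (2, j)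
  let A : Set C := {c | c ∈ (affineRelationMap u).ker ∧ ∑ j, c (2, j) = -1 ∧
    ∑ j, c (0, j) ≠ 0 ∧ p₀ c - p₂ c ≠ 0}
  have hsub : ∀ z ∈ planesThrough 1 (fun a j => u (a, j)), ∃ c ∈ A,
      z = lineThrough (p₂ c) (p₀ c - p₂ c) := by
    intro z hz
    choose w hw hz using hz
    have hne : ∀ a b, a ≠ b → ∑ j, w a j • u (a, j) ≠ ∑ j, w b j • u (b, j) := fun a b hab =>
      hu.sum_smul_ne hm hab (hw a) (hw b)
    obtain ⟨t, ht⟩ := exists_smul_eq_of_mem_incidence_one (hz 0) (hz 1) (hz 2)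
      (hne 0 1 (by decide))
    have ht1 : 1 - t ≠ 0 := fun h => hne 2 1 (by decide) (by
      rw [ht, h, (by linarith : t = 1)]
      simp)
    -- The relation expresses that the third point is the combination of the first two with weights
    -- `1 - t` and `t`.
    let c : C := fun i => ![1 - t, t, -1] i.1 * w i.1 i.2
    have hc0 : ∀ j, c (0, j) = (1 - t) * w 0 j := fun j => rfl
    have hc1 : ∀ j, c (1, j) = t * w 1 j := fun j => rfl
    have hc2 : ∀ j, c (2, j) = -1 * w 2 j := fun j => rfl
    have hs0 : ∑ j, c (0, j) = 1 - t := by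
      simp_rw [hc0]; rw [← Finset.mul_sum, hw, mul_one]
    have hs1 : ∑ j, c (1, j) = t := by
      simp_rw [hc1]; rw [← Finset.mul_sum, hw, mul_one]
    have hs2 : ∑ j, c (2, j) = -1 := by
      simp_rw [hc2]; rw [← Finset.mul_sum, hw, mul_one]
    have hv0 : ∑ j, c (0, j) • u (0, j) = (1 - t) • ∑ j, w 0 j • u (0, j) := by
      simp_rw [hc0, mul_smul]; rw [← Finset.smul_sum]
    have hv1 : ∑ j, c (1, j) • u (1, j) = t • ∑ j, w 1 j • u (1, j) := by
      simp_rw [hc1, mul_smul]; rw [← Finset.smul_sum]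
    have hv2 : ∑ j, c (2, j) • u (2, j) = -∑ j, w 2 j • u (2, j) := by
      simp_rw [hc2, mul_smul]; rw [← Finset.smul_sum, neg_one_smul]
    have hp0 : p₀ c = ∑ j, w 0 j • u (0, j) := by
      simp only [p₀]
      rw [hs0, hv0, smul_smul, inv_mul_cancel₀ ht1, one_smul]
    have hp2 : p₂ c = ∑ j, w 2 j • u (2, j) := by
      simp only [p₂]
      rw [hv2, neg_neg]
    have hr : p₀ c - p₂ c ≠ 0 := by
      rw [hp0, hp2]
      exact sub_ne_zero.2 (hne 0 2 (by decide))
    refine ⟨c, ⟨?_, hs2, by rw [hs0]; exact ht1, hr⟩, ?_⟩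
    · rw [mem_ker_affineRelationMap, Fintype.sum_prod_type, Fintype.sum_prod_type,
        Fin.sum_univ_three, Fin.sum_univ_three, hs0, hs1, hs2, hv0, hv1, hv2, ht]
      refine ⟨by ring, by abel⟩
    · rw [hp0, hp2]
      exact eq_lineThrough (hz 2) (sub_mem_direction_of_mem_incidence (hz 2) (hz 0))
        (sub_ne_zero.2 (hne 0 2 (by decide)))
  obtain ⟨c₀, hc₀, -⟩ := hsub _ hne.some_mem
  let s : C →ₗ[ℝ] ℝ := ∑ j : Fin (n + 1), LinearMap.proj (2, j)
  have hs : ∀ c : C, s c = ∑ j, c (2, j) := fun c => by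
    simp only [s, LinearMap.sum_apply]
    rfl
  let W : Submodule ℝ C := (affineRelationMap u).ker ⊓ s.ker
  -- Strictness comes from `c₀`, which lies in the kernel but not in `W`; this is where nonemptiness
  -- enters.
  have hW : Module.finrank ℝ W < 3 * n + 2 - m := by
    have h1 : W < (affineRelationMap u).ker := by
      refine lt_of_le_of_ne inf_le_left fun h => ?_
      have h2 : c₀ ∈ W := h ▸ hc₀.1
      have h3 : s c₀ = 0 := h2.2
      rw [hs, hc₀.2.1] at h3
      norm_num at h3
    have h2 := (Submodule.finrank_lt_finrank_of_lt h1).trans_le hu.finrank_ker_le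
    rw [Fintype.card_prod, Fintype.card_fin, Fintype.card_fin] at h2
    omega
  let Φ : W → PlaneSpace m := fun w => lineThrough (p₂ (c₀ + w)) (p₀ (c₀ + w) - p₂ (c₀ + w))
  have hsub' : planesThrough 1 (fun a j => u (a, j)) ⊆ Φ '' {w : W | c₀ + (w : C) ∈ A} := by
    intro z hz
    obtain ⟨c, hc, rfl⟩ := hsub z hz
    have hcW : c - c₀ ∈ W := by
      refine ⟨Submodule.sub_mem _ hc.1 hc₀.1, ?_⟩
      change s (c - c₀) = 0
      rw [map_sub, hs, hs, hc.2.1, hc₀.2.1, sub_self]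
    have hcc : c₀ + (c - c₀) = c := by abel
    refine ⟨⟨c - c₀, hcW⟩, ?_, ?_⟩
    · change c₀ + (c - c₀) ∈ A
      rwa [hcc]
    · simp only [Φ]
      rw [hcc]
  refine ((dimH_mono hsub').trans (dimH_image_le_finrank fun w hw => ?_)).trans_lt
    (by exact_mod_cast hW)
  have hadd : ContDiff ℝ 1 fun w : W => c₀ + (w : C) := contDiff_const.add W.subtypeL.contDiff
  have hco : ∀ i, ContDiff ℝ 1 fun w : W => (c₀ + (w : C)) i := fun i =>
    (contDiff_apply ℝ ℝ i).comp hadd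
  have h2 : ContDiff ℝ 1 fun w : W => p₂ (c₀ + (w : C)) :=
    (ContDiff.sum fun j _ => (hco (2, j)).smul contDiff_const).neg
  have h0 : ContDiffAt ℝ 1 (fun w : W => p₀ (c₀ + (w : C))) w := by
    have ha : ContDiff ℝ 1 fun w : W => ∑ j, (c₀ + (w : C)) (0, j) :=
      ContDiff.sum fun j _ => hco (0, j)
    have hb : ContDiff ℝ 1 fun w : W => ∑ j, (c₀ + (w : C)) (0, j) • u (0, j) :=
      ContDiff.sum fun j _ => (hco (0, j)).smul contDiff_const
    exact (ha.contDiffAt.inv hw.2.2.1).smul hb.contDiffAt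
  exact contDiffAt_lineThrough h2.contDiffAt (h0.sub h2.contDiffAt) hw.2.2.2

/-! ### Lines meeting four lines in three-space -/

/-- The determinant that vanishes when some line through `p` meets the three lines through `a i` and
`b i`. -/
def transversalDet {R : Type*} [CommRing R] (a b : Fin 3 → Fin 3 → R) (p : Fin 3 → R) : R :=
  Matrix.det (Matrix.of fun i => crossProduct (a i - p) (b i - p))

/-- The rows are normal to the planes joining `p` to the three lines, and a transversal through `p`
has a direction `r` orthogonal to all of them. -/
theorem transversalDet_eq_zero {a b : Fin 3 → Fin 3 → ℝ} {p r : Fin 3 → ℝ} (hr : r ≠ 0)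
    (h : ∀ i, ∃ w w' s : ℝ, s ≠ 0 ∧ w • (a i - p) + w' • (b i - p) = s • r) :
    transversalDet a b p = 0 := by
  refine Matrix.exists_mulVec_eq_zero_iff.1 ⟨r, hr, ?_⟩
  ext i
  obtain ⟨w, w', s, hs, hw⟩ := h i
  have h1 : s * (crossProduct (a i - p) (b i - p) ⬝ᵥ r) = 0 := by
    rw [← smul_eq_mul, ← dotProduct_smul, ← hw]
    simp only [cross_apply, dotProduct, Fin.sum_univ_three, Pi.add_apply, Pi.smul_apply,
      smul_eq_mul, Matrix.cons_val_zero, Matrix.cons_val_one, Matrix.cons_val]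
    ring
  exact (mul_eq_zero.1 h1).resolve_left hs

theorem exists_polynomial_eval_eq_transversalDet (a b : Fin 3 → Fin 3 → ℝ) (p q : Fin 3 → ℝ) :
    ∃ Q : Polynomial ℝ, ∀ t, Q.eval t = transversalDet a b (p + t • q) := by
  refine ⟨transversalDet (fun i k => .C (a i k)) (fun i k => .C (b i k))
    (fun k => .C (p k) + .X * .C (q k)), fun t => ?_⟩
  simp only [transversalDet, Matrix.det_fin_three, cross_apply, Matrix.of_apply,
    Matrix.cons_val_zero, Matrix.cons_val_one, Matrix.cons_val, Pi.sub_apply, Pi.add_apply,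
    Pi.smul_apply, smul_eq_mul, Polynomial.eval_sub, Polynomial.eval_mul, Polynomial.eval_add,
    Polynomial.eval_C, Polynomial.eval_X]

theorem analyticOnNhd_transversalDet {ι : Type*} [Fintype ι] (a b : Fin 3 → ι) (p : ι) :
    AnalyticOnNhd ℝ (fun v : ι → Euc 3 =>
      transversalDet (fun i => (v (a i)).ofLp) (fun i => (v (b i)).ofLp) (v p).ofLp) univ := by
  rw [← contDiff_omega_iff_analyticOnNhd]
  have hco : ∀ (i : ι) (k : Fin 3), ContDiff ℝ ⊤ fun v : ι → Euc 3 => (v i).ofLp k := fun i k =>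
    (EuclideanSpace.proj k : Euc 3 →L[ℝ] ℝ).contDiff.comp (contDiff_apply ℝ (Euc 3) i)
  simp only [transversalDet, Matrix.det_fin_three, cross_apply, Matrix.of_apply,
    Matrix.cons_val_zero, Matrix.cons_val_one, Matrix.cons_val, Pi.sub_apply]
  fun_prop

/-- The sides of the standard triangle, seen from the origin, have the coordinate vectors as
normals. -/
theorem exists_transversalDet_ne_zero {ι : Type*} (e : Fin 4 × Fin 2 ↪ ι) :
    ∃ v : ι → Euc 3, transversalDet (fun i => (v (e (i.castSucc, 0))).ofLp)
      (fun i => (v (e (i.castSucc, 1))).ofLp) (v (e (3, 0))).ofLp ≠ 0 := by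
  let c : Fin 4 × Fin 2 → Euc 3 := fun p =>
    (![![!₂[1, 0, 0], !₂[0, 1, 0]], ![!₂[0, 1, 0], !₂[0, 0, 1]], ![!₂[0, 0, 1], !₂[1, 0, 0]],
      ![0, 0]] : Fin 4 → Fin 2 → Euc 3) p.1 p.2
  refine ⟨Function.extend e c 0, ?_⟩
  simp only [e.injective.extend_apply]
  simp [transversalDet, Matrix.det_fin_three, cross_apply, c]

/-- For eight points in general position in `ℝ^3`, only finitely many lines meet the four lines
determined by them. -/
theorem finite_planesThrough_four {u : Fin 4 × Fin 2 → Euc 3} (hu : InGeneralPosition u)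
    (hdet : transversalDet (fun i => (u (i.castSucc, 0)).ofLp)
      (fun i => (u (i.castSucc, 1)).ofLp) (u (3, 0)).ofLp ≠ 0) :
    (planesThrough 1 fun a j => u (a, j)).Finite := by
  obtain ⟨Q, hQ⟩ := exists_polynomial_eval_eq_transversalDet
    (fun i => (u (i.castSucc, 0)).ofLp) (fun i => (u (i.castSucc, 1)).ofLp) (u (3, 0)).ofLp
    ((u (3, 1)).ofLp - (u (3, 0)).ofLp)
  have hQ0 : Q ≠ 0 := by
    rintro rfl
    apply hdet
    simpa using (hQ 0).symm
  have hchoice : ∀ z ∈ planesThrough 1 (fun a j => u (a, j)), ∃ w : Fin 4 → Fin 2 → ℝ,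
      ∀ a, ∑ j, w a j = 1 ∧ (∑ j, w a j • u (a, j), z) ∈ incidence 3 1 := by
    intro z hz
    choose w hw using hz
    exact ⟨w, hw⟩
  choose! w hw using hchoice
  let P : PlaneSpace 3 → Fin 4 → Euc 3 := fun z a => ∑ j, w z a j • u (a, j)
  have hsum : ∀ z ∈ planesThrough 1 (fun a j => u (a, j)), ∀ a, w z a 0 + w z a 1 = 1 :=
    fun z hz a => by
      have := (hw z hz a).1
      rwa [Fin.sum_univ_two] at this
  have hPz : ∀ z ∈ planesThrough 1 (fun a j => u (a, j)), ∀ a, (P z a, z) ∈ incidence 3 1 :=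
    fun z hz a => (hw z hz a).2
  have hne : ∀ z ∈ planesThrough 1 (fun a j => u (a, j)), ∀ a b, a ≠ b → P z a ≠ P z b :=
    fun z hz a b hab =>
      hu.sum_smul_ne (n := 1) le_rfl hab (hw z hz a).1 (hw z hz b).1
  -- The position of a transversal on the fourth line is a root of `Q`, which is nonzero because `Q`
  -- does not vanish at `0`.
  have hroot : MapsTo (fun z => w z 3 1) (planesThrough 1 fun a j => u (a, j))
      {t | Q.IsRoot t} := by
    intro z hz
    change Q.eval _ = 0
    have h3 : (u (3, 0)).ofLp + w z 3 1 • ((u (3, 1)).ofLp - (u (3, 0)).ofLp) =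
        (P z 3).ofLp := by
      have h1 := hsum z hz 3
      simp only [P, Fin.sum_univ_two, WithLp.ofLp_add, WithLp.ofLp_smul]
      rw [(by linarith : w z 3 0 = 1 - w z 3 1)]
      module
    rw [hQ, h3]
    refine transversalDet_eq_zero (r := (P z 0 - P z 3).ofLp) ?_ fun i => ?_
    · intro h
      refine hne z hz 0 3 (by decide) (sub_eq_zero.1 ?_)
      ext k
      exact congrFun h k
    · obtain ⟨s, hs⟩ := exists_smul_eq_of_mem_incidence_one (hPz z hz 3) (hPz z hz 0)
        (hPz z hz i.castSucc) (hne z hz 3 0 (by decide))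
      have hi : i.castSucc ≠ 3 := (Fin.castSucc_lt_last i).ne
      refine ⟨w z i.castSucc 0, w z i.castSucc 1, s, ?_, ?_⟩
      · rintro rfl
        refine hne z hz i.castSucc 3 hi ?_
        rw [hs]
        simp
      · have h1 := hsum z hz i.castSucc
        have h2 : P z i.castSucc - P z 3 = s • (P z 0 - P z 3) := by
          rw [hs]
          module
        have h5 := congrArg WithLp.ofLp h2
        rw [WithLp.ofLp_smul, WithLp.ofLp_sub] at h5
        rw [← h5]
        have h4 : (P z i.castSucc).ofLp = w z i.castSucc 0 • (u (i.castSucc, 0)).ofLp +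
            w z i.castSucc 1 • (u (i.castSucc, 1)).ofLp := by
          simp only [P, Fin.sum_univ_two, WithLp.ofLp_add, WithLp.ofLp_smul]
        rw [h4, (by linarith : w z i.castSucc 0 = 1 - w z i.castSucc 1)]
        module
  -- It remains to see that the point on the fourth line determines the transversal; the idea is
  -- that the first two lines are skew.
  refine Finite.of_finite_image ((Polynomial.finite_setOfPred_isRoot hQ0).subset
    (image_subset_iff.2 hroot)) ?_
  intro z hz z' hz' ht
  dsimp only at ht
  have h3 : P z 3 = P z' 3 := by
    have h1 := hsum z hz 3
    have h2 := hsum z' hz' 3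
    simp only [P, Fin.sum_univ_two]
    rw [ht, (by linarith : w z 3 0 = w z' 3 0)]
  obtain ⟨s, hs⟩ := exists_smul_eq_of_mem_incidence_one (hPz z hz 3) (hPz z hz 0)
    (hPz z hz 1) (hne z hz 3 0 (by decide))
  obtain ⟨s', hs'⟩ := exists_smul_eq_of_mem_incidence_one (hPz z' hz' 3) (hPz z' hz' 0)
    (hPz z' hz' 1) (hne z' hz' 3 0 (by decide))
  have hs0 : s ≠ 0 := fun h => hne z hz 1 3 (by decide) (by rw [hs, h]; simp)
  have hs1 : 1 - s ≠ 0 := fun h => hne z hz 1 0 (by decide) (by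
    rw [hs, (by linarith : s = 1)]; simp)
  have hs1' : 1 - s' ≠ 0 := fun h => hne z' hz' 1 0 (by decide) (by
    rw [hs', (by linarith : s' = 1)]; simp)
  -- Eliminating the common point on the fourth line leaves an affine relation among the four
  -- vertices of the first two lines, so all its coefficients vanish.
  have hrel : (1 - s') • (P z 1 - s • P z 0) - (1 - s) • (P z' 1 - s' • P z' 0) = 0 := by
    rw [hs, hs', h3]
    module
  let A : Fin 2 → ℝ := (s' * (1 - s)) • w z' 0 - (s * (1 - s')) • w z 0
  let B : Fin 2 → ℝ := (1 - s') • w z 1 - (1 - s) • w z' 1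
  have hAB : ∑ j, A j + ∑ j, B j = 0 := by
    simp only [A, B, Pi.sub_apply, Pi.smul_apply, smul_eq_mul, Fin.sum_univ_two]
    linear_combination (s' * (1 - s)) * hsum z' hz' 0 - (s * (1 - s')) * hsum z hz 0 +
      (1 - s') * hsum z hz 1 - (1 - s) * hsum z' hz' 1
  have hABu : ∑ j, A j • u (0, j) + ∑ j, B j • u (1, j) = 0 := by
    rw [← hrel]
    simp only [P, A, B, Pi.sub_apply, Pi.smul_apply, smul_eq_mul, Fin.sum_univ_two]
    module
  obtain ⟨h0, h1⟩ := hu.eq_zero_of_pair (n := 1) le_rfl (show (0 : Fin 4) ≠ 1 by decide) hAB hABu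
  have hss : s = s' := by
    have h2 := congrArg (fun f : Fin 2 → ℝ => ∑ j, f j) h1
    simp only [B, Pi.sub_apply, Pi.smul_apply, smul_eq_mul, Fin.sum_univ_two, Pi.zero_apply] at h2
    linear_combination h2 - (1 - s') * hsum z hz 1 + (1 - s) * hsum z' hz' 1
  subst hss
  have hw0 : w z' 0 = w z 0 := by
    change (s * (1 - s)) • w z' 0 - (s * (1 - s)) • w z 0 = 0 at h0
    rw [← smul_sub] at h0
    exact sub_eq_zero.1 ((smul_eq_zero.1 h0).resolve_left (mul_ne_zero hs0 hs1))
  have hP0 : P z 0 = P z' 0 := by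
    simp only [P, hw0]
  have hline : ∀ z ∈ planesThrough 1 (fun a j => u (a, j)),
      z = lineThrough (P z 3) (P z 0 - P z 3) := fun z hz =>
    eq_lineThrough (hPz z hz 3) (sub_mem_direction_of_mem_incidence (hPz z hz 3) (hPz z hz 0))
      (sub_ne_zero.2 (hne z hz 0 3 (by decide)))
  rw [hline z hz, hline z' hz', hP0, h3]

/-! ### The main theorem -/

/-- The dense `G_δ` property of `fiberwiseDimSet` follows from a perturbation property of finite
families of points. -/
theorem isDenseGdelta_fiberwiseDimSet_of_perturbation {X Y : Type*} [TopologicalSpace X]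
    [TopologicalSpace.MetrizableSpace X] [TopologicalSpace Y] [TopologicalSpace.MetrizableSpace Y]
    {f : X → Y} (hf : IsProperMap f) {n : ℕ} (hn : ∀ y : Y, CoveringDimLE (f ⁻¹' {y}) n)
    (hY : CoveringDimLE Y 0) {q d m : ℕ} (hq : 0 < q) (k : ℤ) {K : ℕ} (hK : (k + 1).toNat = K)
    (hgen : ∀ (ι : Type) [Finite ι] (v₀ : ι → Euc m) (η : ℝ), 0 < η →
      ∃ v : ι → Euc m, (∀ i, dist (v₀ i) (v i) < η) ∧ ∀ e : Fin q × Fin (n + 1) ↪ ι,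
        (planesThrough d fun a j => v (e (a, j))).Nonempty →
          dimH (planesThrough d fun a j => v (e (a, j))) < K) :
    IsDenseGdeltaSourceLimitation (fiberwiseDimSet f q d m k) := by
  let _ := TopologicalSpace.metrizableSpaceMetric X
  refine isDenseGdelta_fiberwiseDimSet hf
    ((coveringDimLE_iff_coverOrderLE Y 0).1 hY) hq k fun g y δ hδ ε hε η hη => ?_
  rw [hK]
  have hn' : CoverOrderLE (f ⁻¹' {y}) (n + 1) := by
    have := (coveringDimLE_iff_coverOrderLE _ _).1 (hn y)
    rwa [show ((n : ℤ) + 1).toNat = n + 1 by omega] at this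
  exact exists_approximation_smallCover_secants hq hgen
    (hf.isCompact_preimage isCompact_singleton) hn' g hδ hε hη

theorem exists_near_inGeneralPosition_of_finite {ι : Type*} [Finite ι] {m : ℕ} (v₀ : ι → Euc m)
    {η : ℝ} (hη : 0 < η) : ∃ v : ι → Euc m, (∀ i, dist (v₀ i) (v i) < η) ∧ InGeneralPosition v := by
  obtain ⟨v, hv, hvg, -⟩ := exists_near_inGeneralPosition (I := Empty) (fun i _ => i.elim)
    (fun i => i.elim) (fun i => i.elim) v₀ hη
  exact ⟨v, hv, hvg⟩

theorem theorem1p2 {X Y : Type*} [TopologicalSpace X] [TopologicalSpace.MetrizableSpace X]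
    [TopologicalSpace Y] [TopologicalSpace.MetrizableSpace Y]
    (f : X → Y) (hf : IsProperMap f)
    (n : ℕ) (hn : ∀ y : Y, CoveringDimLE (f ⁻¹' {y}) n)
    (hY : CoveringDimLE Y 0) :
    (∀ m : ℕ, 2 * n + 1 ≤ m →
      IsDenseGdeltaSourceLimitation (fiberwiseDimSet f 3 1 m (3 * (n : ℤ) + 1 - (m : ℤ)))) ∧
    (∀ m : ℕ, 2 * n + 1 ≤ m →
      IsDenseGdeltaSourceLimitation (fiberwiseDimSet f 2 1 m (2 * (n : ℤ)))) ∧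
    (∀ d m : ℕ, n + d ≤ m →
      IsDenseGdeltaSourceLimitation
        (fiberwiseDimSet f 1 d m ((n : ℤ) + (d : ℤ) * ((m : ℤ) - (d : ℤ))))) ∧
    (n = 1 → IsDenseGdeltaSourceLimitation (fiberwiseDimSet f 4 1 3 0)) := by
  refine ⟨fun m hm => ?_, fun m hm => ?_, fun d m hm => ?_, ?_⟩
  · refine isDenseGdelta_fiberwiseDimSet_of_perturbation hf hn hY (by norm_num) _
      (K := 3 * n + 2 - m) (by omega) fun ι _ v₀ η hη => ?_
    obtain ⟨v, hv, hvg⟩ := exists_near_inGeneralPosition_of_finite v₀ hη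
    exact ⟨v, hv, fun e hne => dimH_planesThrough_three_lt (hvg.comp e) hm hne⟩
  · refine isDenseGdelta_fiberwiseDimSet_of_perturbation hf hn hY (by norm_num) _
      (K := 2 * n + 1) (by omega) fun ι _ v₀ η hη => ?_
    obtain ⟨v, hv, hvg⟩ := exists_near_inGeneralPosition_of_finite v₀ hη
    exact ⟨v, hv, fun e _ => dimH_planesThrough_two_lt (hvg.comp e) hm⟩
  · refine isDenseGdelta_fiberwiseDimSet_of_perturbation hf hn hY (by norm_num) _
      (K := n + d * (m - d) + 1) ?_ fun ι _ v₀ η hη =>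
        ⟨v₀, fun i => by simpa using hη, fun e _ => dimH_planesThrough_one_lt _⟩
    -- Since `d ≤ m`, the truncated difference in `K` agrees with the integer one.
    have : ((m : ℤ) - d) = ((m - d : ℕ) : ℤ) := by omega
    rw [this]
    exact_mod_cast Int.toNat_natCast (n + d * (m - d) + 1)
  · rintro rfl
    refine isDenseGdelta_fiberwiseDimSet_of_perturbation hf hn hY (by norm_num) _
      (K := 1) (by norm_num) fun ι _ v₀ η hη => ?_
    have := Finite.of_injective (fun e : Fin 4 × Fin 2 ↪ ι => (e : Fin 4 × Fin 2 → ι))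
      DFunLike.coe_injective
    obtain ⟨v, hv, hvg, hdet⟩ := exists_near_inGeneralPosition
      (I := Fin 4 × Fin 2 ↪ ι) (m := 3)
      (fun e v => transversalDet (fun i => (v (e (i.castSucc, 0))).ofLp)
        (fun i => (v (e (i.castSucc, 1))).ofLp) (v (e (3, 0))).ofLp)
      (fun e => analyticOnNhd_transversalDet _ _ _) exists_transversalDet_ne_zero v₀ hη
    refine ⟨v, hv, fun e _ => ?_⟩
    have := finite_planesThrough_four (hvg.comp e) (hdet e)
    exact this.dimH_zero.trans_lt (by norm_num)
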